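/- Let $B$ be a finite dimensional C$^*$-algebra, let $J$ be an arbitrary set, and for every $\iota\in J$ let $D_\iota$ be a finite dimensional C$^*$-algebra containing $B$ as a unital C$^*$-subalgebra, with a conditional expectation $\psi_\iota:D_\iota\to B$ whose GNS representation (on the Hilbert $B$-module $L^2(D_\iota,\psi_\iota)$) is faithful. Let $(D,\psi)=*_{\iota\in J}(D_\iota,\psi_\iota)$ be the reduced amalgamated free product over $B$, i.e. the pair, unique up to isomorphism, of a unital C$^*$-algebra $D$ containing $B$ as a unital C$^*$-subalgebra and a conditional expectation $\psi:D\to B$ with faithful GNS representation, with unital $*$-homomorphisms $D_\iota\to D$ that are the identity on $B$ and carry $\psi_\iota$ to $\psi$, such that $D$ is generated by $B$ and the images of the $D_\iota$, and $\psi(a_1a_2\cdots a_n)=0$ whenever $n\ge1$, each $a_k$ is the image of an element of $\ker\psi_{\iota_k}$, and $\iota_1\ne\iota_2,\ \iota_2\ne\iota_3,\ldots,\ \iota_{n-1}\ne\iota_n$. Then $(D,\psi)$ has the ZEFP property: for every set $I$, every reduced amalgamated free product $(A,\phi)=*_{i\in I}(A_i,\phi_i)$ over $B$ of copies $(A_i,\phi_i)$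 of $(D,\psi)$, and every permutation $\sigma$ of $I$, the free permutation $\sigma_*$ (the automorphism of $A$ that is the identity on $B$ and carries the copy $A_i$ of $D$ identically to the copy $A_{\sigma(i)}$, for every $i\in I$) exists and satisfies $ht(\sigma_*)=0$. Here $ht$ is the Brown-Voiculescu topological entropy: for a faithful representation $\pi:A\to L(H)$ on a Hilbert space, a finite set $\omega\subseteq A$ and $\delta>0$, let $rcp(\pi,\omega,\delta)$ be the least rank (dimension of a maximal abelian $*$-subalgebra) of a nonzero finite dimensional C$^*$-algebra $C$ for which there are contractive completely positive maps $\Phi:A\to C$ and $\Psi:C\to L(H)$ with $\|\Psi(\Phi(a))-\pi(a)\|<\delta$ for all $a\in\omega$ (and $\infty$ if there is none). Then $$ht(\pi,\alpha)=\sup_{\omega,\ \delta>0}\ \limsup_{n\to\infty}\frac1n\log rcp\bigl(\pi,\omega\cup\alpha(\omega)\cup\cdots\cup\alpha^{n-1}(\omega),\delta\bigr),$$ which is the same for all faithful $\pi$, and $ht(\alpha)$ is defined to be this value; equivalently, $ht(\alpha)=\inf_\pi ht(\pi,\alpha)$ over all faithful $\pi$. -/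

import Mathlib

open scoped CStarAlgebra ENNReal

universe u v w x uB uJ uDj uD uI uA

noncomputable section

/-! ### Conditional expectations onto a unital C⋆-subalgebra -/

/-- `B` as a unital C⋆-subalgebra of the unital C⋆-algebra `A` (through the unital
`*`-homomorphism `incl`, which is injective by `exp_incl`), together with a conditional expectation
from `A` onto `B`: a positive `B`-bimodule map that restricts to the identity of `B`. -/
structure CondExp (B : Type u) (A : Type v) [CStarAlgebra B] [PartialOrder B] [StarOrderedRing B]
    [CStarAlgebra A] where
  /-- the inclusion of `B` in `A` -/
  incl : B →⋆ₐ[ℂ] A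
  /-- the conditional expectation -/
  exp : A →ₗ[ℂ] B
  exp_incl : ∀ b : B, exp (incl b) = b
  exp_bimodule : ∀ (b : B) (a : A) (c : B), exp (incl b * a * incl c) = b * exp a * c
  exp_nonneg : ∀ a : A, 0 ≤ exp (star a * a)

namespace CondExp

variable {B : Type u} {A : Type v} [CStarAlgebra B] [PartialOrder B] [StarOrderedRing B]
  [CStarAlgebra A]

/-- The GNS representation of `φ`, i.e. left multiplication on the Hilbert `B`-module `L²(A, φ)`
obtained from `A` with the `B`-valued inner product `⟨x, y⟩ = φ (x⋆ y)` by separation and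
completion, is faithful: an element `a` that acts as zero, i.e. for which the class of `a x` has
`⟨a x, a x⟩ = 0` for all `x` in `A`, is zero. -/
def FaithfulGNS (φ : CondExp B A) : Prop :=
  ∀ a : A, (∀ x : A, φ.exp (star (a * x) * (a * x)) = 0) → a = 0

end CondExp

/-! ### Reduced amalgamated free products -/

section FreeProduct

variable {B : Type u} [CStarAlgebra B] [PartialOrder B] [StarOrderedRing B]

/-- `(A, φ)`, with the embeddings `emb i : A i → A`, is the reduced amalgamated free product over
`B` of the pairs `(A i, E i)`. This is Voiculescu's characterization of it, which determines
`(A, φ)` and the embeddings up to isomorphism: the embeddings agree on `B` and carry `E i` to `φ`,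
`A` is generated as a C⋆-algebra by `B` and the `A i`, the `A i` are free with amalgamation over
`B` with respect to `φ`, and the GNS representation of `φ` is faithful. (Each `emb i` is injective
as soon as the GNS representation of `E i` is faithful.) -/
structure IsReducedFreeProduct {I : Type w} {Ai : I → Type x} [∀ i, CStarAlgebra (Ai i)]
    (E : ∀ i, CondExp B (Ai i)) {A : Type v} [CStarAlgebra A] (φ : CondExp B A)
    (emb : ∀ i, Ai i →⋆ₐ[ℂ] A) : Prop where
  emb_incl : ∀ i (b : B), emb i ((E i).incl b) = φ.incl b
  exp_emb : ∀ i (a : Ai i), φ.exp (emb i a) = (E i).exp a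
  generates : (StarAlgebra.adjoin ℂ
    (Set.range φ.incl ∪ ⋃ i, Set.range (emb i))).topologicalClosure = ⊤
  /-- `φ (a₁ a₂ ⋯ aₙ) = 0` if `n ≥ 1`, each `aₖ` is in the copy of some `A iₖ` and in the kernel of
  its conditional expectation, and consecutive indices are different. -/
  free : ∀ l : List (Σ i, Ai i), l ≠ [] → l.IsChain (fun p q => p.1 ≠ q.1) →
    (∀ p ∈ l, (E p.1).exp p.2 = 0) → φ.exp (l.map fun p => emb p.1 p.2).prod = 0
  faithful : φ.FaithfulGNS

end FreeProduct

/-! ### Brown–Voiculescu topological entropy -/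

section Entropy

/-- The rank of a finite dimensional C⋆-algebra: the largest dimension of a commutative
`*`-subalgebra (so that it is `∑ nₖ` for a direct sum of full matrix algebras of sizes `nₖ`). -/
def cstarRank (C : Type u) [CStarAlgebra C] : ℕ∞ :=
  ⨆ (S : StarSubalgebra ℂ C) (_ : ∀ a ∈ S, ∀ b ∈ S, a * b = b * a), (Module.finrank ℂ S : ℕ∞)

variable {A : Type v} [CStarAlgebra A] [PartialOrder A] [StarOrderedRing A]

/-- A completely positive approximation, within `δ` on the set `ω`, of the representation `π` of
`A` on the Hilbert space `H` through a finite dimensional C⋆-algebra `C` (not zero, so that the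
logarithm of its rank is not negative): contractive completely positive maps
`A → C → L(H)`. -/
structure CPApprox {H : Type w} [NormedAddCommGroup H] [InnerProductSpace ℂ H] [CompleteSpace H]
    (π : A →⋆ₐ[ℂ] (H →L[ℂ] H)) (ω : Set A) (δ : ℝ) where
  C : Type
  [cstar : CStarAlgebra C]
  [order : PartialOrder C]
  [orderedRing : StarOrderedRing C]
  [nontriv : Nontrivial C]
  [finDim : FiniteDimensional ℂ C]
  down : A →CP C
  up : C →CP (H →L[ℂ] H)
  norm_down_le : ∀ a, ‖down a‖ ≤ ‖a‖
  norm_up_le : ∀ c, ‖up c‖ ≤ ‖c‖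
  approx : ∀ a ∈ ω, ‖up (down a) - π a‖ < δ

/-- `rcp(π, ω, δ)`: the least rank of an approximation, and `⊤` if there is none. -/
def rcp {H : Type w} [NormedAddCommGroup H] [InnerProductSpace ℂ H] [CompleteSpace H]
    (π : A →⋆ₐ[ℂ] (H →L[ℂ] H)) (ω : Set A) (δ : ℝ) : ℕ∞ :=
  ⨅ F : CPApprox π ω δ, @cstarRank F.C F.cstar

/-- `ht(π, α, ω, δ)`, the exponential growth rate of
`rcp(π, ω ∪ α(ω) ∪ ⋯ ∪ αⁿ⁻¹(ω), δ)`. -/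
def htGrowth {H : Type w} [NormedAddCommGroup H] [InnerProductSpace ℂ H] [CompleteSpace H]
    (π : A →⋆ₐ[ℂ] (H →L[ℂ] H)) (α : A ≃⋆ₐ[ℂ] A) (ω : Set A) (δ : ℝ) : EReal :=
  Filter.limsup (fun n : ℕ =>
    ENNReal.log ((rcp π (⋃ k ∈ Finset.range n, (⇑α)^[k] '' ω) δ : ℕ∞) : ℝ≥0∞) / (n : EReal))
    Filter.atTop

/-- `ht(π, α)`: the supremum of `ht(π, α, ω, δ)` over all finite `ω ⊆ A` and all `δ > 0`. -/
def htRep {H : Type w} [NormedAddCommGroup H] [InnerProductSpace ℂ H] [CompleteSpace H]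
    (π : A →⋆ₐ[ℂ] (H →L[ℂ] H)) (α : A ≃⋆ₐ[ℂ] A) : EReal :=
  ⨆ (ω : Finset A) (δ : ℝ) (_ : 0 < δ), htGrowth π α (ω : Set A) δ

/-- The Brown–Voiculescu topological entropy `ht(α)`: the value of `ht(π, α)` for a faithful
representation `π` of `A` on a Hilbert space. By Arveson's extension theorem that value is the same
for all faithful `π`; it is written here as the infimum. It is `⊤` if `A` is not exact. -/
def ht (α : A ≃⋆ₐ[ℂ] A) : EReal :=
  ⨅ (H : Type v) (_ : NormedAddCommGroup H) (_ : InnerProductSpace ℂ H) (_ : CompleteSpace H)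
    (π : A →⋆ₐ[ℂ] (H →L[ℂ] H)) (_ : Function.Injective π), htRep π α

end Entropy

/-! ### Free permutations and the ZEFP property -/

section ZEFP

variable {B : Type u} [CStarAlgebra B] [PartialOrder B] [StarOrderedRing B]
  {D : Type x} [CStarAlgebra D]

/-- `α` is the free permutation of `A` (with copies `emb i` of `D`) given by the permutation `σ` of
the index set: it carries the `i`-th copy of `D` identically onto the `σ i`-th. (That it fixes `B`
follows if there is at least one copy.) -/
def IsFreePermutation {I : Type w} {A : Type v} [CStarAlgebra A] (φ : CondExp B A)
    (emb : I → D →⋆ₐ[ℂ] A) (σ : Equiv.Perm I) (α : A ≃⋆ₐ[ℂ] A) : Prop :=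
  (∀ i d, α (emb i d) = emb (σ i) d) ∧ ∀ b : B, α (φ.incl b) = φ.incl b

/-- The ZEFP property (zero entropy free permutations) of the pair `(D, ψ)`: whenever `(A, φ)` is a
reduced amalgamated free product of copies of `(D, ψ)`, indexed by a set `I`, and `σ` is a
permutation of `I`, the corresponding free permutation of `A` exists and has entropy zero. -/
def HasZEFP (ψ : CondExp B D) : Prop :=
  ∀ (I : Type w) (A : Type v) [CStarAlgebra A] [PartialOrder A] [StarOrderedRing A]
    (φ : CondExp B A) (emb : I → D →⋆ₐ[ℂ] A),
    IsReducedFreeProduct (fun _ : I => ψ) φ emb →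
    ∀ σ : Equiv.Perm I,
      (∃ α : A ≃⋆ₐ[ℂ] A, IsFreePermutation φ emb σ α) ∧
      ∀ α : A ≃⋆ₐ[ℂ] A, IsFreePermutation φ emb σ α → ht α = 0

end ZEFP

end

set_option linter.unusedSectionVars false

noncomputable section

open scoped TensorProduct InnerProductSpace
open TensorProduct InnerProductSpace

/-! ### Completely positive maps from kernels -/

/-! A free product of copies of a free product is again a free product
(`IsReducedFreeProduct.iterate`), so `A` is the free product of finite dimensional algebras indexed
by `I × J`, and the free permutation only relabels indices. Its existence follows from uniqueness of
the reduced free product (`exists_isFreePermutation`). For the entropy, `A` acts on the GNS space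
`H` of `τ ∘ φ`, where `τ` is the trace of the regular representation of `B`. This space is densely
spanned by words of centred letters.

Fix a finite set `S` of indices. For each `k`, the map `split k : H → H ⊗ H` cuts a word after its
first `k` letters, which must have indices in `S`; the tensor product over `B` sits inside `H ⊗ H`
through an orthonormal basis of `B`. A word whose longest initial segment over `S` has `m` letters
can be cut at `0, …, m`. Giving the cuts `k < m` the weight `1/√N` (only while `k < N`) and the cut
`m` the remaining mass makes the weighted sum `splitMean N` isometric (`norm_splitMean`). A letter
with index in `S` changes the length of that segment by at most one, so `splitMean N` intertwines
`x` and `x ⊗ 1` up to `5‖x‖/√N` (`norm_leftLeg_splitMean_sub_le`).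

With `V = splitMean N`, the map `a ↦ V⋆(a ⊗ 1)V` is therefore close to the identity representation.
It factors through the operators on the span of the first legs, whose dimension is polynomial in the
total dimension of the letters over `S` when `N` is fixed (`rcp_le_of_tensor`,
`hasLegRank_combine`). For `n` iterates of a finite set, `S` consists of at most `n` shifts of a
fixed finite set, while `N` depends only on the tolerance. Hence the ranks grow polynomially in `n`,
and the growth rate is zero (`htGrowth_nonpos`).

The choice of `τ` makes scalar orthonormal bases work as frames over `B`: `∑ rₛ⋆ rₛ = ∑ rₛ rₛ⋆ = 1`
(`sum_star_trace_basis_mul`, `sum_trace_basis_mul_star`). -/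

theorem CStarMatrix.nonneg_of_star_mul {C : Type*} [CStarAlgebra C] [PartialOrder C]
    [StarOrderedRing C] {k : ℕ} (r : Fin k → C) :
    (0 : CStarMatrix (Fin k) (Fin k) C) ≤ CStarMatrix.ofMatrix fun p q => star (r p) * r q := by
  rcases k with _ | k
  · exact le_of_eq (by ext p; exact p.elim0)
  · have : (CStarMatrix.ofMatrix fun p q => star (r p) * r q) =
        star (CStarMatrix.ofMatrix fun p q : Fin (k + 1) => if p = 0 then r q else 0) *
          CStarMatrix.ofMatrix fun p q : Fin (k + 1) => if p = 0 then r q else 0 := by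
      ext p q
      rw [CStarMatrix.mul_apply, Fin.sum_univ_succ]
      change star (r p) * r q = star (if (0 : Fin (k + 1)) = 0 then r p else 0) *
        (if (0 : Fin (k + 1)) = 0 then r q else 0) + ∑ x : Fin k,
          star (if x.succ = 0 then r p else 0) * (if x.succ = 0 then r q else 0)
      simp
    rw [this]
    exact star_mul_self_nonneg _

/-- Positive matrices are sums of matrices `N⋆N`, and each row of `N` contributes a Gram matrix
`(xₚ⋆ x_q)`. Complete positivity can thus be tested on such kernels. -/
theorem map_cstarMatrix_nonneg_of_kernel {A C : Type*} [CStarAlgebra A] [PartialOrder A]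
    [StarOrderedRing A] [CStarAlgebra C] [PartialOrder C] [StarOrderedRing C] (Φ : A →ₗ[ℂ] C)
    (h : ∀ (k : ℕ) (x : Fin k → A), ∃ (n : ℕ) (ρ : Fin n → Fin k → C), ∀ p q,
      Φ (star (x p) * x q) = ∑ c, star (ρ c p) * ρ c q)
    (k : ℕ) (M : CStarMatrix (Fin k) (Fin k) A) (hM : 0 ≤ M) : 0 ≤ M.map Φ := by
  rw [StarOrderedRing.nonneg_iff] at hM
  induction hM using AddSubmonoid.closure_induction with
  | zero => exact le_of_eq (by ext p q; simp)
  | add M N _ _ hM hN =>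
    have : (M + N).map Φ = M.map Φ + N.map Φ := by ext p q; simp
    rw [this]
    exact add_nonneg hM hN
  | mem M hM =>
    obtain ⟨N, rfl⟩ := hM
    choose n ρ hρ using fun l => h k (N l)
    have : (star N * N).map Φ =
        ∑ l, ∑ c, CStarMatrix.ofMatrix fun p q => star (ρ l c p) * ρ l c q := by
      ext p q
      have e : ∀ {ι : Type} (s : Finset ι) (g : ι → CStarMatrix (Fin k) (Fin k) C),
          (∑ l ∈ s, g l) p q = ∑ l ∈ s, g l p q := fun s g =>
        (congrFun (Finset.sum_apply p s g) q).trans (Finset.sum_apply q s fun l => g l p)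
      simp only [CStarMatrix.map_apply, CStarMatrix.mul_apply, CStarMatrix.star_apply, map_sum, hρ,
        e]
      rfl
    rw [this]
    exact Finset.sum_nonneg fun l _ => Finset.sum_nonneg fun c _ => CStarMatrix.nonneg_of_star_mul _

/-! ### Approximations from maps into a tensor square -/

section Core

variable {H : Type*} [NormedAddCommGroup H] [InnerProductSpace ℂ H] [CompleteSpace H]

/-- Finitely many vectors lie in the range of a partial isometry from a coordinate space. -/
theorem exists_coordinate_map {ι : Type*} [Fintype ι] (f : ι → H) :
    ∃ n : ℕ, 1 ≤ n ∧ n ≤ Fintype.card ι + 1 ∧ ∃ J : EuclideanSpace ℂ (Fin n) →L[ℂ] H,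
      ‖J‖ ≤ 1 ∧ ∀ i, J (ContinuousLinearMap.adjoint J (f i)) = f i := by
  rcases subsingleton_or_nontrivial H with hH | hH
  · exact ⟨1, le_rfl, by omega, 0, by simp, fun i => Subsingleton.elim _ _⟩
  obtain ⟨v, hv⟩ := exists_ne (0 : H)
  -- The additional nonzero vector keeps the coordinate space nonzero, as the approximating algebra
  -- must be; it accounts for the `+ 1` in the dimension.
  let g : Option ι → H := fun o => o.elim v f
  let E := Submodule.span ℂ (Set.range g)
  have : FiniteDimensional ℂ E := FiniteDimensional.span_of_finite ℂ (Set.finite_range g)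
  let b := stdOrthonormalBasis ℂ E
  let J' : EuclideanSpace ℂ (Fin (Module.finrank ℂ E)) →ₗᵢ[ℂ] H :=
    E.subtypeₗᵢ.comp b.repr.symm.toLinearIsometry
  refine ⟨Module.finrank ℂ E, ?_, ?_, J'.toContinuousLinearMap, J'.norm_toContinuousLinearMap_le,
    fun i => ?_⟩
  · have : Nontrivial E := ⟨⟨⟨v, Submodule.subset_span ⟨none, rfl⟩⟩, 0, by simpa using hv⟩⟩
    exact Module.finrank_pos
  · exact (finrank_range_le_card g).trans (by simp)
  · obtain ⟨w, hw⟩ : ∃ w, J' w = f i :=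
      ⟨b.repr ⟨f i, Submodule.subset_span ⟨some i, rfl⟩⟩, by simp [J']⟩
    have h : ContinuousLinearMap.adjoint J'.toContinuousLinearMap (J' w) = w :=
      ext_inner_left ℂ fun z => by
        rw [ContinuousLinearMap.adjoint_inner_right]
        exact J'.inner_map_map z w
    rw [← hw, h]
    rfl


omit [CompleteSpace H] in
theorem norm_map_le_of_contraction {E F : Type*} [NormedAddCommGroup E] [InnerProductSpace ℂ E]
    [NormedAddCommGroup F] [InnerProductSpace ℂ F] (T : E →L[ℂ] F) (z : E ⊗[ℂ] H) :
    ‖mapL T (1 : H →L[ℂ] H) z‖ ≤ ‖T‖ * ‖z‖ := by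
  refine ((mapL T (1 : H →L[ℂ] H)).le_opNorm z).trans ?_
  refine mul_le_mul_of_nonneg_right ((norm_mapL_le T 1).trans ?_) (norm_nonneg z)
  exact mul_le_of_le_one_right (norm_nonneg T) ContinuousLinearMap.norm_id_le

/-- The compression of a representation to a coordinate space, as a completely positive map. -/
def compressCP {A : Type*} [CStarAlgebra A] [PartialOrder A] [StarOrderedRing A]
    (π : A →⋆ₐ[ℂ] (H →L[ℂ] H)) {n : ℕ} (hn : 1 ≤ n) (J : EuclideanSpace ℂ (Fin n) →L[ℂ] H) :
    A →CP (EuclideanSpace ℂ (Fin n) →L[ℂ] EuclideanSpace ℂ (Fin n)) where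
  toFun a := ContinuousLinearMap.adjoint J ∘L π a ∘L J
  map_add' a b := by ext; simp
  map_smul' c a := by ext; simp
  map_cstarMatrix_nonneg' := by
    refine map_cstarMatrix_nonneg_of_kernel (Φ := ⟨⟨fun a => ContinuousLinearMap.adjoint J ∘L π a ∘L J, _⟩, _⟩) fun k x => ?_
    -- The operators `π (x p) J` map into `H`, whereas the factors of the kernel must act on the
    -- coordinate space. Their joint range is finite dimensional, so its coordinates, attached to a
    -- unit vector `e`, serve as factors.
    obtain ⟨m, -, -, L, -, hL⟩ := exists_coordinate_map
      fun q : Fin k × Fin n => π (x q.1) (J (EuclideanSpace.single q.2 1))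
    have hL' : ∀ p v, L (ContinuousLinearMap.adjoint L (π (x p) (J v))) = π (x p) (J v) := by
      intro p
      have : (L ∘L ContinuousLinearMap.adjoint L ∘L π (x p) ∘L J).toLinearMap =
          (π (x p) ∘L J).toLinearMap :=
        (EuclideanSpace.basisFun (Fin n) ℂ).toBasis.ext fun j => by simpa using hL (p, j)
      exact fun v => DFunLike.congr_fun this v
    let e : EuclideanSpace ℂ (Fin n) := EuclideanSpace.single ⟨0, hn⟩ 1
    have he : ⟪e, e⟫_ℂ = 1 := by simp [e]
    refine ⟨m, fun c p => rankOne ℂ e (L (EuclideanSpace.single c 1)) ∘L π (x p) ∘L J,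
      fun p q => ?_⟩
    refine ContinuousLinearMap.ext fun v => ext_inner_left ℂ fun w => ?_
    simp only [LinearMap.coe_mk, AddHom.coe_mk, map_mul, map_star,
      ContinuousLinearMap.star_eq_adjoint, sum_apply, inner_sum,
      mul_apply_eq_comp, ContinuousLinearMap.comp_apply,
      ContinuousLinearMap.adjoint_inner_right, rankOne_apply, inner_smul_left, inner_smul_right, he]
    rw [← hL' q v, ← ContinuousLinearMap.adjoint_inner_left,
      ← (EuclideanSpace.basisFun (Fin m) ℂ).sum_inner_mul_inner]
    refine Finset.sum_congr rfl fun c _ => ?_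
    rw [EuclideanSpace.basisFun_apply, ContinuousLinearMap.adjoint_inner_left,
      ContinuousLinearMap.adjoint_inner_right, hL', inner_conj_symm]
    ring

theorem compressCP_apply {A : Type*} [CStarAlgebra A] [PartialOrder A] [StarOrderedRing A]
    (π : A →⋆ₐ[ℂ] (H →L[ℂ] H)) {n : ℕ} (hn : 1 ≤ n) (J : EuclideanSpace ℂ (Fin n) →L[ℂ] H)
    (a : A) : compressCP π hn J a = ContinuousLinearMap.adjoint J ∘L π a ∘L J := rfl

/-- The completely positive map `T ↦ ∑ ⟨u i, T (u j)⟩ (W i)⋆ W j`. -/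
def expandCP {ι : Type*} [Fintype ι] {n : ℕ} (u : ι → EuclideanSpace ℂ (Fin n))
    (W : ι → H →L[ℂ] H) :
    (EuclideanSpace ℂ (Fin n) →L[ℂ] EuclideanSpace ℂ (Fin n)) →CP (H →L[ℂ] H) where
  toFun T := ∑ i, ∑ j, ⟪u i, T (u j)⟫_ℂ • (ContinuousLinearMap.adjoint (W i) ∘L W j)
  map_add' S T := by simp [add_smul, Finset.sum_add_distrib]
  map_smul' c T := by simp [mul_smul, Finset.smul_sum]
  map_cstarMatrix_nonneg' := by
    refine map_cstarMatrix_nonneg_of_kernel (Φ := ⟨⟨_, _⟩, _⟩) fun k x => ?_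
    refine ⟨n, fun c p => ∑ i, ⟪EuclideanSpace.single c (1 : ℂ), x p (u i)⟫_ℂ • W i,
      fun p q => ?_⟩
    simp only [LinearMap.coe_mk, AddHom.coe_mk, ContinuousLinearMap.star_eq_adjoint]
    refine ContinuousLinearMap.ext fun v => ext_inner_left ℂ fun w => ?_
    have h : ∀ i j, ⟪x p (u i), x q (u j)⟫_ℂ = ∑ c,
        ⟪x p (u i), EuclideanSpace.single c (1 : ℂ)⟫_ℂ *
          ⟪EuclideanSpace.single c (1 : ℂ), x q (u j)⟫_ℂ := fun i j => by
      have := (EuclideanSpace.basisFun (Fin n) ℂ).sum_inner_mul_inner (x p (u i)) (x q (u j))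
      simp only [EuclideanSpace.basisFun_apply] at this
      rw [this]
    simp only [sum_apply, smul_apply, inner_sum, mul_apply_eq_comp, ContinuousLinearMap.comp_apply,
      sum_inner, ContinuousLinearMap.adjoint_inner_right, inner_smul_left, inner_smul_right,
      inner_conj_symm]
    simp only [h, Finset.mul_sum, Finset.sum_mul]
    rw [Finset.sum_comm]
    refine ((Finset.sum_congr rfl fun j _ => Finset.sum_comm).trans Finset.sum_comm).trans ?_
    refine Finset.sum_congr rfl fun c _ => Finset.sum_congr rfl fun j _ =>
      Finset.sum_congr rfl fun i _ => ?_
    ring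

/-- This is the form `V⋆(T ⊗ 1)V` with `V ξ = ∑ u i ⊗ W i ξ`, from which contractivity is read off
without completing the tensor product. -/
theorem inner_expandCP {ι : Type*} [Fintype ι] {n : ℕ} (u : ι → EuclideanSpace ℂ (Fin n))
    (W : ι → H →L[ℂ] H) (T : EuclideanSpace ℂ (Fin n) →L[ℂ] EuclideanSpace ℂ (Fin n)) (ξ η : H) :
    ⟪ξ, expandCP u W T η⟫_ℂ =
      ⟪∑ i, u i ⊗ₜ[ℂ] W i ξ, mapL T (1 : H →L[ℂ] H) (∑ i, u i ⊗ₜ[ℂ] W i η)⟫_ℂ := by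
  change ⟪ξ, (∑ i, ∑ j, ⟪u i, T (u j)⟫_ℂ • (ContinuousLinearMap.adjoint (W i) ∘L W j)) η⟫_ℂ = _
  simp only [sum_apply, smul_apply, inner_sum,
      ContinuousLinearMap.comp_apply, sum_inner, map_sum,
      ContinuousLinearMap.adjoint_inner_right, inner_smul_right, mapL_tmul, inner_tmul,
      one_apply_eq_self]
  rw [Finset.sum_comm]

theorem cstarRank_le_finrank (C : Type*) [CStarAlgebra C] [FiniteDimensional ℂ C] :
    cstarRank C ≤ Module.finrank ℂ C :=
  iSup₂_le fun S _ => by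
    exact_mod_cast Submodule.finrank_le (StarSubalgebra.toSubalgebra S).toSubmodule

/-- The rank is bounded crudely by the dimension; squaring a polynomial bound does no harm. -/
theorem cstarRank_operators_le (n : ℕ) :
    cstarRank (EuclideanSpace ℂ (Fin n) →L[ℂ] EuclideanSpace ℂ (Fin n)) ≤ (n ^ 2 : ℕ) := by
  refine (cstarRank_le_finrank _).trans (le_of_eq ?_)
  rw [← LinearMap.toContinuousLinearMap.finrank_eq, Module.finrank_linearMap,
    finrank_euclideanSpace_fin, sq]

/-- A map `V : H → H ⊗ H` of finite rank in the first leg that almost intertwines `π a ⊗ 1` and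
`π a` for `a ∈ ω` gives a completely positive approximation. -/
theorem rcp_le_of_tensor {A : Type*} [CStarAlgebra A] [PartialOrder A] [StarOrderedRing A]
    (π : A →⋆ₐ[ℂ] (H →L[ℂ] H)) {ω : Set A} {δ ε : ℝ} (hε : 0 ≤ ε) (hεδ : ε < δ)
    (V : H →ₗ[ℂ] H ⊗[ℂ] H) (hV : ∀ ξ, ‖V ξ‖ ≤ ‖ξ‖) {ι : Type*} [Fintype ι] (f : ι → H)
    (W : ι → H →L[ℂ] H) (hfW : ∀ ξ, V ξ = ∑ i, f i ⊗ₜ[ℂ] W i ξ)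
    (happ : ∀ a ∈ ω, ∀ ξ η, ‖⟪V ξ, mapL (π a) (1 : H →L[ℂ] H) (V η)⟫_ℂ - ⟪ξ, π a η⟫_ℂ‖ ≤
      ε * ‖ξ‖ * ‖η‖) :
    rcp π ω δ ≤ ((Fintype.card ι + 1) ^ 2 : ℕ) := by
  obtain ⟨n, hn, hn', J, hJ, hJf⟩ := exists_coordinate_map f
  have hJa : ‖ContinuousLinearMap.adjoint J‖ ≤ 1 := by rwa [LinearIsometryEquiv.norm_map]
  have : Nonempty (Fin n) := ⟨⟨0, hn⟩⟩
  let u := fun i => ContinuousLinearMap.adjoint J (f i)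
  have hu : ∀ ξ, ∑ i, u i ⊗ₜ[ℂ] W i ξ =
      mapL (ContinuousLinearMap.adjoint J) (1 : H →L[ℂ] H) (V ξ) := fun ξ => by
    simp [hfW, u]
  have hu' : ∀ ξ, ‖∑ i, u i ⊗ₜ[ℂ] W i ξ‖ ≤ ‖ξ‖ := fun ξ => by
    rw [hu]
    exact ((norm_map_le_of_contraction _ _).trans (mul_le_of_le_one_left (norm_nonneg _) hJa)).trans
      (hV ξ)
  -- The compression to the coordinate space loses nothing, because `J J⋆` fixes the first legs `f
  -- i`.
  have key : ∀ a ξ η, ⟪ξ, expandCP u W (compressCP π hn J a) η⟫_ℂ =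
      ⟪V ξ, mapL (π a) (1 : H →L[ℂ] H) (V η)⟫_ℂ := fun a ξ η => by
    rw [inner_expandCP, compressCP_apply]
    simp only [hfW, map_sum, mapL_tmul, sum_inner, inner_sum, inner_tmul,
      ContinuousLinearMap.comp_apply, ContinuousLinearMap.adjoint_inner_right, u, hJf]
  have hE : Nontrivial (EuclideanSpace ℂ (Fin n)) := inferInstance
  let F : CPApprox π ω δ :=
    { C := EuclideanSpace ℂ (Fin n) →L[ℂ] EuclideanSpace ℂ (Fin n)
      down := compressCP π hn J
      up := expandCP u W
      norm_down_le := fun a => by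
        rw [compressCP_apply]
        refine (ContinuousLinearMap.opNorm_comp_le _ _).trans ?_
        refine (mul_le_of_le_one_left (norm_nonneg _) hJa).trans ?_
        refine (ContinuousLinearMap.opNorm_comp_le _ _).trans ?_
        refine (mul_le_of_le_one_right (norm_nonneg _) hJ).trans ?_
        exact NonUnitalStarAlgHom.norm_apply_le π a
      norm_up_le := fun T => by
        refine ContinuousLinearMap.opNorm_le_of_re_inner_le (norm_nonneg T) fun η ξ hη hξ => ?_
        rw [← inner_conj_symm, inner_expandCP, RCLike.conj_re]
        refine (Complex.re_le_norm _).trans ?_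
        have h1 := norm_inner_le_norm (𝕜 := ℂ) (∑ i, u i ⊗ₜ[ℂ] W i ξ)
          (mapL T (1 : H →L[ℂ] H) (∑ i, u i ⊗ₜ[ℂ] W i η))
        have h2 := norm_map_le_of_contraction T (∑ i, u i ⊗ₜ[ℂ] W i η)
        have h3 := mul_le_mul (hu' ξ) (h2.trans (mul_le_mul_of_nonneg_left (hu' η) (norm_nonneg T)))
          (norm_nonneg _) (norm_nonneg _)
        rw [hη, hξ, one_mul, mul_one] at h3
        exact h1.trans h3
      approx := fun a ha => by
        refine lt_of_le_of_lt (ContinuousLinearMap.opNorm_le_of_re_inner_le hε fun η ξ hη hξ => ?_) hεδ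
        rw [← inner_conj_symm, RCLike.conj_re, sub_apply, inner_sub_right, key]
        refine (Complex.re_le_norm _).trans ((happ a ha ξ η).trans_eq (by rw [hη, hξ]; ring)) }
  have h0 : rcp π ω δ ≤ cstarRank (EuclideanSpace ℂ (Fin n) →L[ℂ] EuclideanSpace ℂ (Fin n)) :=
    iInf_le (fun F : CPApprox π ω δ => @cstarRank F.C F.cstar) F
  refine (h0.trans (cstarRank_operators_le n)).trans ?_
  exact_mod_cast Nat.pow_le_pow_left hn' 2

end Core

/-! ### Operators on the two legs of a tensor square -/

section Legs

variable {H : Type*} [NormedAddCommGroup H] [InnerProductSpace ℂ H] [CompleteSpace H]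

/-- `T ↦ T ⊗ 1`. -/
def leftLeg : (H →L[ℂ] H) →ₐ[ℂ] Module.End ℂ (H ⊗[ℂ] H) :=
  AlgHom.ofLinearMap
    ⟨⟨fun T => LinearMap.rTensor H T.toLinearMap, fun _ _ => LinearMap.rTensor_add H _ _⟩,
      fun c _ => LinearMap.rTensor_smul H c _⟩
    (LinearMap.rTensor_id H H) fun _ _ => LinearMap.rTensor_comp H _ _

/-- `T ↦ 1 ⊗ T`. -/
def rightLeg : (H →L[ℂ] H) →ₐ[ℂ] Module.End ℂ (H ⊗[ℂ] H) :=
  AlgHom.ofLinearMap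
    ⟨⟨fun T => LinearMap.lTensor H T.toLinearMap, fun _ _ => LinearMap.lTensor_add H _ _⟩,
      fun c _ => LinearMap.lTensor_smul H c _⟩
    (LinearMap.lTensor_id H H) fun _ _ => LinearMap.lTensor_comp H _ _

omit [CompleteSpace H] in
@[simp] theorem leftLeg_tmul (T : H →L[ℂ] H) (x y : H) :
    leftLeg T (x ⊗ₜ[ℂ] y) = T x ⊗ₜ[ℂ] y := rfl

omit [CompleteSpace H] in
@[simp] theorem rightLeg_tmul (T : H →L[ℂ] H) (x y : H) :
    rightLeg T (x ⊗ₜ[ℂ] y) = x ⊗ₜ[ℂ] T y := rfl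

omit [CompleteSpace H] in
theorem leftLeg_apply (T : H →L[ℂ] H) (z : H ⊗[ℂ] H) :
    leftLeg T z = mapL T (1 : H →L[ℂ] H) z := by
  induction z using TensorProduct.induction_on with
  | zero => simp
  | tmul x y => simp
  | add x y hx hy => rw [map_add, map_add, hx, hy]

omit [CompleteSpace H] in
theorem norm_leftLeg_le (T : H →L[ℂ] H) (z : H ⊗[ℂ] H) : ‖leftLeg T z‖ ≤ ‖T‖ * ‖z‖ := by
  rw [leftLeg_apply]
  exact norm_map_le_of_contraction T z

omit [CompleteSpace H] in
theorem leftLeg_rightLeg (S T : H →L[ℂ] H) (z : H ⊗[ℂ] H) :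
    leftLeg S (rightLeg T z) = rightLeg T (leftLeg S z) := by
  induction z using TensorProduct.induction_on with
  | zero => simp
  | tmul x y => simp
  | add x y hx hy => simp only [map_add, hx, hy]

theorem inner_leftLeg (T : H →L[ℂ] H) (z w : H ⊗[ℂ] H) :
    ⟪leftLeg T z, w⟫_ℂ = ⟪z, leftLeg (star T) w⟫_ℂ := by
  induction z using TensorProduct.induction_on with
  | zero => simp
  | add x y hx hy => simp only [map_add, inner_add_left, hx, hy]
  | tmul x y =>
    induction w using TensorProduct.induction_on with
    | zero => simp
    | add u v hu hv => simp only [map_add, inner_add_right, hu, hv]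
    | tmul u v => simp [ContinuousLinearMap.star_eq_adjoint, ContinuousLinearMap.adjoint_inner_right]

theorem inner_rightLeg (T : H →L[ℂ] H) (z w : H ⊗[ℂ] H) :
    ⟪rightLeg T z, w⟫_ℂ = ⟪z, rightLeg (star T) w⟫_ℂ := by
  induction z using TensorProduct.induction_on with
  | zero => simp
  | add x y hx hy => simp only [map_add, inner_add_left, hx, hy]
  | tmul x y =>
    induction w using TensorProduct.induction_on with
    | zero => simp
    | add u v hu hv => simp only [map_add, inner_add_right, hu, hv]
    | tmul u v => simp [ContinuousLinearMap.star_eq_adjoint, ContinuousLinearMap.adjoint_inner_right]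

end Legs

/-! ### Splitting off initial segments of words -/

section Fock

variable {B H K : Type*} [DecidableEq K] [CStarAlgebra B] [NormedAddCommGroup H] [InnerProductSpace ℂ H]
  [CompleteSpace H]

/-- Projections `P i` onto the vectors that begin with a letter from `M i`, in the operator theoretic
description of a free product over `B`. -/
structure FreeCompression (β : B →⋆ₐ[ℂ] (H →L[ℂ] H)) (M : K → StarSubalgebra ℂ (H →L[ℂ] H))
    (P : K → H →L[ℂ] H) (Ω : H) : Prop where
  star_proj : ∀ i, star (P i) = P i
  mul_self : ∀ i, P i * P i = P i
  orth : ∀ i j, i ≠ j → P i * P j = 0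
  comm : ∀ i b, P i * β b = β b * P i
  vacuum : ∀ i b, P i (β b Ω) = 0
  incl_mem : ∀ i b, β b ∈ M i
  compress : ∀ i, ∀ y ∈ M i, ∃ b, (1 - P i) * y * (1 - P i) = β b * (1 - P i)

namespace FreeCompression

variable {β : B →⋆ₐ[ℂ] (H →L[ℂ] H)} {M : K → StarSubalgebra ℂ (H →L[ℂ] H)}
  {P : K → H →L[ℂ] H} {Ω : H} (hP : FreeCompression β M P Ω)
include hP

omit [DecidableEq K] in
theorem compl_mul_self (i : K) : (1 - P i) * (1 - P i) = 1 - P i := by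
  rw [mul_sub, sub_mul, sub_mul, hP.mul_self]
  simp

omit [DecidableEq K] in
theorem star_compl (i : K) : star (1 - P i) = 1 - P i := by
  rw [star_sub, star_one, hP.star_proj]

end FreeCompression

/-- Finite frames of the centred letters with index in the finite set `S`, and of `B`. -/
structure LetterFrame (β : B →⋆ₐ[ℂ] (H →L[ℂ] H)) (M : K → StarSubalgebra ℂ (H →L[ℂ] H))
    (P : K → H →L[ℂ] H) (Ω : H) (S : Finset K) where
  G : Type
  [fintypeG : Fintype G]
  idx : G → K
  idx_mem : ∀ g, idx g ∈ S
  e : G → H →L[ℂ] H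
  e_mem : ∀ g, e g ∈ M (idx g)
  centred : ∀ g, (1 - P (idx g)) * e g * (1 - P (idx g)) = 0
  frame : ∀ i ∈ S, P i = ∑ g with idx g = i, e g * (1 - P i) * star (e g)
  R : Type
  [fintypeR : Fintype R]
  r : R → B
  frame_comm : ∀ b ξ, ∑ s, β b (β (r s) Ω) ⊗ₜ[ℂ] star (β (r s)) ξ =
    ∑ s, β (r s) Ω ⊗ₜ[ℂ] star (β (r s)) (β b ξ)
  frame_inner : ∀ X : H →L[ℂ] H, (∀ b, X * β b = β b * X) → ∀ ξ η,
    ⟪∑ s, β (r s) Ω ⊗ₜ[ℂ] star (β (r s)) ξ,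
      ∑ s, β (r s) Ω ⊗ₜ[ℂ] X (star (β (r s)) η)⟫_ℂ = ⟪ξ, X η⟫_ℂ

attribute [instance] LetterFrame.fintypeG LetterFrame.fintypeR

namespace LetterFrame

variable {β : B →⋆ₐ[ℂ] (H →L[ℂ] H)} {M : K → StarSubalgebra ℂ (H →L[ℂ] H)}
  {P : K → H →L[ℂ] H} {Ω : H} {S : Finset K} (F : LetterFrame β M P Ω S)

/-- Creation of the letter `g`. -/
def creation (g : F.G) : H →L[ℂ] H := F.e g * (1 - P (F.idx g))

/-- Splitting off the first `k` letters. -/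
def split : ℕ → H →ₗ[ℂ] H ⊗[ℂ] H
  | 0 => ∑ s, (TensorProduct.mk ℂ H H (β (F.r s) Ω)).comp (star (β (F.r s))).toLinearMap
  | k + 1 => ∑ g, (leftLeg (F.creation g)).comp ((split k).comp (star (F.creation g)).toLinearMap)

theorem split_zero_apply (ξ : H) :
    F.split 0 ξ = ∑ s, β (F.r s) Ω ⊗ₜ[ℂ] star (β (F.r s)) ξ := by
  simp [split]

theorem split_succ_apply (k : ℕ) (ξ : H) :
    F.split (k + 1) ξ = ∑ g, leftLeg (F.creation g) (F.split k (star (F.creation g) ξ)) := by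
  simp [split]

/-- The projection onto the vectors that begin with a letter with index in `S`. -/
def firstIn (_ : LetterFrame β M P Ω S) : H →L[ℂ] H := ∑ i ∈ S, P i

theorem proj_creation (g : F.G) : P (F.idx g) * F.creation g = F.creation g := by
  have h := F.centred g
  have : (1 - P (F.idx g)) * F.e g * (1 - P (F.idx g)) =
    F.creation g - P (F.idx g) * F.creation g := by simp only [creation]; noncomm_ring
  rw [this, sub_eq_zero] at h
  exact h.symm

variable (hP : FreeCompression β M P Ω)
include hP

theorem proj_creation_of_ne {i : K} {g : F.G} (h : F.idx g ≠ i) : P i * F.creation g = 0 := by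
  rw [← F.proj_creation, ← mul_assoc, hP.orth _ _ (Ne.symm h), zero_mul]

theorem star_creation (g : F.G) :
    star (F.creation g) = (1 - P (F.idx g)) * star (F.e g) := by
  rw [creation, star_mul, hP.star_compl]

theorem star_creation_mul_proj (g : F.G) :
    star (F.creation g) * P (F.idx g) = star (F.creation g) := by
  conv_rhs => rw [← F.proj_creation, star_mul, hP.star_proj]

theorem star_creation_mul_proj_of_ne {i : K} {g : F.G} (h : F.idx g ≠ i) :
    star (F.creation g) * P i = 0 := by
  rw [← hP.star_proj i, ← star_mul, F.proj_creation_of_ne hP h, star_zero]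

theorem sum_creation {i : K} (hi : i ∈ S) :
    ∑ g with F.idx g = i, F.creation g * star (F.creation g) = P i := by
  rw [F.frame i hi]
  refine Finset.sum_congr rfl fun g hg => ?_
  obtain rfl := (Finset.mem_filter.mp hg).2
  rw [F.star_creation hP, creation, ← mul_assoc, mul_assoc _ _ (1 - P _), hP.compl_mul_self]

theorem sum_e_star_creation {i : K} (hi : i ∈ S) :
    ∑ g with F.idx g = i, F.e g * star (F.creation g) = P i := by
  rw [F.frame i hi]
  refine Finset.sum_congr rfl fun g hg => ?_
  obtain rfl := (Finset.mem_filter.mp hg).2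
  rw [F.star_creation hP, ← mul_assoc]

/-- When at least one letter has been split off, the first letter of a word is also the first letter
of its left leg. -/
theorem leftLeg_proj_split_succ (i : K) (k : ℕ) (ξ : H) :
    leftLeg (P i) (F.split (k + 1) ξ) = F.split (k + 1) (P i ξ) := by
  rw [split_succ_apply, split_succ_apply, map_sum]
  refine Finset.sum_congr rfl fun g _ => ?_
  rw [← Module.End.mul_apply, ← map_mul, ← mul_apply_eq_comp (star (F.creation g)) (P i)]
  by_cases h : F.idx g = i
  · subst h
    rw [F.proj_creation, F.star_creation_mul_proj hP]
  · rw [F.proj_creation_of_ne hP h, F.star_creation_mul_proj_of_ne hP h]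
    simp

theorem sum_filter_split (i : K) (k : ℕ) (ξ : H) :
    ∑ g with F.idx g = i, leftLeg (F.creation g) (F.split k (star (F.creation g) ξ)) =
      F.split (k + 1) (P i ξ) := by
  rw [split_succ_apply, Finset.sum_filter]
  refine Finset.sum_congr rfl fun g _ => ?_
  rw [← mul_apply_eq_comp (star (F.creation g)) (P i)]
  split_ifs with h
  · subst h
    rw [F.star_creation_mul_proj hP]
  · rw [F.star_creation_mul_proj_of_ne hP h]
    simp

theorem leftLeg_proj_split_zero (i : K) (ξ : H) : leftLeg (P i) (F.split 0 ξ) = 0 := by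
  simp [split_zero_apply, hP.vacuum]

theorem leftLeg_compl_split {i : K} {ξ : H} (h : P i ξ = 0) (k : ℕ) :
    leftLeg (1 - P i) (F.split k ξ) = F.split k ξ := by
  rw [map_sub, map_one, LinearMap.sub_apply, Module.End.one_apply]
  cases k with
  | zero => rw [F.leftLeg_proj_split_zero hP, sub_zero]
  | succ k => rw [F.leftLeg_proj_split_succ hP, h, map_zero, sub_zero]

/-- Between vectors that do not begin with `i`, an element of `M i` acts like an element of `B`. The
hypothesis of `B`-linearity is stated for the single level `k` so that `leftLeg_incl_split` can be
proved by induction. -/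
theorem leftLeg_compress_of_comm {k : ℕ}
    (hk : ∀ b ξ, leftLeg (β b) (F.split k ξ) = F.split k (β b ξ)) {i : K} {y : H →L[ℂ] H}
    (hy : y ∈ M i) {ξ : H} (hξ : P i ξ = 0) :
    leftLeg ((1 - P i) * y * (1 - P i)) (F.split k ξ) = F.split k (((1 - P i) * y) ξ) := by
  obtain ⟨b, hb⟩ := hP.compress i y hy
  have h1 : (1 - P i) ξ = ξ := by simp [hξ]
  have h2 : ((1 - P i) * y) ξ = β b ξ := by
    have := DFunLike.congr_fun hb ξ
    rwa [mul_apply_eq_comp, h1, mul_apply_eq_comp (β b), h1] at this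
  rw [hb, map_mul, Module.End.mul_apply, F.leftLeg_compl_split hP hξ, hk, h2]

theorem proj_star_creation (g : F.G) (ξ : H) : P (F.idx g) (star (F.creation g) ξ) = 0 := by
  rw [← mul_apply_eq_comp, F.star_creation hP, ← mul_assoc, mul_sub, hP.mul_self, mul_one, sub_self,
    zero_mul]
  rfl

/-- Moving an operator through the first letter. -/
theorem leftLeg_letter_of_comm {k : ℕ}
    (hk : ∀ b ξ, leftLeg (β b) (F.split k ξ) = F.split k (β b ξ)) {i : K} (hi : i ∈ S)
    {y : H →L[ℂ] H} (hy : y ∈ M i) (ξ : H) :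
    leftLeg ((1 - P i) * y * P i) (F.split (k + 1) ξ) = F.split k (((1 - P i) * y * P i) ξ) := by
  rw [map_mul, Module.End.mul_apply, F.leftLeg_proj_split_succ hP, ← F.sum_filter_split hP, map_sum]
  -- Write `P i` as the sum of the `e g * star (creation g)`. After the letter is removed, `(1 - P
  -- i) y (e g) (1 - P i)` is the compression of an element of `M i`, hence acts through `B`.
  have hs : (1 - P i) * y * P i =
      ∑ g with F.idx g = i, (1 - P i) * y * (F.e g * star (F.creation g)) := by
    rw [← Finset.mul_sum, F.sum_e_star_creation hP hi]
  rw [hs, sum_apply, map_sum]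
  refine Finset.sum_congr rfl fun g hg => ?_
  obtain rfl := (Finset.mem_filter.mp hg).2
  rw [← Module.End.mul_apply, ← map_mul, creation, ← mul_assoc, mul_assoc _ y, ← creation,
    F.leftLeg_compress_of_comm hP hk (mul_mem hy (F.e_mem g)) (F.proj_star_creation hP g ξ)]
  rw [← mul_apply_eq_comp]
  simp only [mul_assoc]

/-- Here the first letter is replaced by another one of the same index. Expanding the left `P i` in
creations reduces this to letter removal by `star (creation g) * y`. -/
theorem leftLeg_corner_of_comm {k : ℕ}
    (hk : ∀ b ξ, leftLeg (β b) (F.split k ξ) = F.split k (β b ξ)) {i : K} (hi : i ∈ S)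
    {y : H →L[ℂ] H} (hy : y ∈ M i) (ξ : H) :
    leftLeg (P i * y * P i) (F.split (k + 1) ξ) = F.split (k + 1) ((P i * y * P i) ξ) := by
  rw [mul_assoc, mul_apply_eq_comp, ← F.sum_filter_split hP]
  nth_rw 1 [← F.sum_creation hP hi]
  rw [Finset.sum_mul, map_sum, LinearMap.sum_apply]
  refine Finset.sum_congr rfl fun g hg => ?_
  obtain rfl := (Finset.mem_filter.mp hg).2
  have h : star (F.creation g) * (y * P (F.idx g)) =
      (1 - P (F.idx g)) * (star (F.e g) * y) * P (F.idx g) := by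
    rw [F.star_creation hP]; noncomm_ring
  rw [mul_assoc, map_mul, Module.End.mul_apply, h,
    F.leftLeg_letter_of_comm hP hk hi (mul_mem (star_mem (F.e_mem g)) hy), ← h]
  rfl

theorem split_firstIn (k : ℕ) (ξ : H) : F.split (k + 1) (F.firstIn ξ) = F.split (k + 1) ξ := by
  classical
  rw [firstIn, sum_apply, map_sum]
  simp only [← F.sum_filter_split hP]
  rw [split_succ_apply, Finset.sum_fiberwise_of_maps_to fun g _ => F.idx_mem g]

theorem firstIn_comm (b : B) : F.firstIn * β b = β b * F.firstIn := by
  rw [firstIn, Finset.sum_mul, Finset.mul_sum]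
  exact Finset.sum_congr rfl fun i _ => hP.comm i b

/-- For `k = 0` this is balance over `B`, a property of the frame. For `k + 1` only vectors
beginning in `S` matter, and there `B` acts within the corners of the `P i`. -/
theorem leftLeg_incl_split (k : ℕ) : ∀ b ξ, leftLeg (β b) (F.split k ξ) = F.split k (β b ξ) := by
  induction k with
  | zero =>
    intro b ξ
    simp only [split_zero_apply, map_sum, leftLeg_tmul]
    exact F.frame_comm b ξ
  | succ k ih =>
    intro b ξ
    have h : ∀ i ∈ S, leftLeg (β b) (F.split (k + 1) (P i ξ)) =
        F.split (k + 1) (P i (β b ξ)) := fun i hi => by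
      have h1 : P i * β b * P i = β b * P i := by
        rw [hP.comm, mul_assoc, hP.mul_self]
      have h2 := F.leftLeg_corner_of_comm hP ih hi (hP.incl_mem i b) ξ
      rw [h1, map_mul, Module.End.mul_apply, F.leftLeg_proj_split_succ hP, ← hP.comm] at h2
      exact h2
    rw [← F.split_firstIn hP, ← F.split_firstIn hP k (β b ξ), firstIn, sum_apply, map_sum, map_sum,
      sum_apply, map_sum]
    exact Finset.sum_congr rfl h

end LetterFrame

end Fock

/-! ### Orthogonality of the splittings -/

section FockEstimate

variable {B H K : Type*} [DecidableEq K] [CStarAlgebra B] [NormedAddCommGroup H]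
  [InnerProductSpace ℂ H] [CompleteSpace H]

namespace LetterFrame

variable {β : B →⋆ₐ[ℂ] (H →L[ℂ] H)} {M : K → StarSubalgebra ℂ (H →L[ℂ] H)}
  {P : K → H →L[ℂ] H} {Ω : H} {S : Finset K} (F : LetterFrame β M P Ω S)
  (hP : FreeCompression β M P Ω)
include hP

theorem leftLeg_star_creation_split_zero (g : F.G) (ξ : H) :
    leftLeg (star (F.creation g)) (F.split 0 ξ) = 0 := by
  rw [← F.star_creation_mul_proj, map_mul, Module.End.mul_apply, F.leftLeg_proj_split_zero hP,
    map_zero]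
  all_goals exact hP

theorem leftLeg_star_creation_split_succ (g : F.G) (k : ℕ) (ξ : H) :
    leftLeg (star (F.creation g)) (F.split (k + 1) ξ) = F.split k (star (F.creation g) ξ) := by
  have h : star (F.creation g) =
      (1 - P (F.idx g)) * star (F.e g) * P (F.idx g) := by
    rw [← F.star_creation hP, F.star_creation_mul_proj hP]
  rw [h]
  exact F.leftLeg_letter_of_comm hP (F.leftLeg_incl_split hP k) (F.idx_mem g)
    (star_mem (F.e_mem g)) ξ

/-- The creation part of `x` puts a letter in front and so raises the cutting position by one. In
coordinates, `star (creation g) * x` acts through `B` on vectors not beginning with `i`. -/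
theorem leftLeg_split_of_proj_eq_zero {i : K} (hi : i ∈ S) {x : H →L[ℂ] H} (hx : x ∈ M i) {ξ : H}
    (hξ : P i ξ = 0) (k : ℕ) :
    leftLeg (P i * x * (1 - P i)) (F.split k ξ) =
      F.split (k + 1) ((P i * x * (1 - P i)) ξ) := by
  have h1 : (1 - P i) ξ = ξ := by simp [hξ]
  rw [mul_assoc (P i), mul_apply_eq_comp, ← F.sum_filter_split hP]
  nth_rw 1 [← F.sum_creation hP hi]
  rw [Finset.sum_mul, map_sum, LinearMap.sum_apply]
  refine Finset.sum_congr rfl fun g hg => ?_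
  obtain rfl := (Finset.mem_filter.mp hg).2
  have h : star (F.creation g) * (x * (1 - P (F.idx g))) =
      (1 - P (F.idx g)) * (star (F.e g) * x) * (1 - P (F.idx g)) := by
    rw [F.star_creation hP]; noncomm_ring
  rw [mul_assoc, map_mul, Module.End.mul_apply, h,
    F.leftLeg_compress_of_comm hP (F.leftLeg_incl_split hP k)
      (mul_mem (star_mem (F.e_mem g)) hx) hξ, ← mul_apply_eq_comp (star _), h,
    mul_apply_eq_comp _ (1 - P (F.idx g)), h1]

/-- A centred letter is the sum of a creation, a preserving and an annihilation part, shifting the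
cut by `+1`, `0` and `-1`. -/
theorem leftLeg_letter_split_succ {i : K} (hi : i ∈ S) {x : H →L[ℂ] H} (hx : x ∈ M i)
    (hc : (1 - P i) * x * (1 - P i) = 0) (k : ℕ) (ξ : H) :
    leftLeg x (F.split (k + 1) ξ) = F.split (k + 2) ((P i * x * (1 - P i)) ξ) +
      F.split (k + 1) ((P i * x * P i) ξ) + F.split k (((1 - P i) * x * P i) ξ) := by
  have hx' : x = P i * x * (1 - P i) + P i * x * P i + (1 - P i) * x * P i +
    (1 - P i) * x * (1 - P i) := by noncomm_ring
  have h0 : P i ((1 - P i) ξ) = 0 := by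
    rw [← mul_apply_eq_comp, mul_sub, hP.mul_self, mul_one, sub_self]; rfl
  have h1 : leftLeg (P i * x * (1 - P i)) (F.split (k + 1) ξ) =
      F.split (k + 2) ((P i * x * (1 - P i)) ξ) := by
    rw [← hP.compl_mul_self, ← mul_assoc, map_mul, Module.End.mul_apply, map_sub _ 1, map_one,
      LinearMap.sub_apply, F.leftLeg_proj_split_succ hP, Module.End.one_apply, ← map_sub,
      mul_apply_eq_comp _ (1 - P i)]
    exact F.leftLeg_split_of_proj_eq_zero hP hi hx h0 (k + 1)
  conv_lhs => rw [hx', hc, add_zero, map_add, map_add, LinearMap.add_apply, LinearMap.add_apply]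
  rw [h1, F.leftLeg_corner_of_comm hP (F.leftLeg_incl_split hP k) hi hx,
    F.leftLeg_letter_of_comm hP (F.leftLeg_incl_split hP k) hi hx]

/-- At the cut `0` the left leg lies in `B Ω`, so `x` can only create. If the right leg already
begins with `i`, the new letter and the rest do not form a reduced word; the term with `P i ξ` is
this boundary error. -/
theorem leftLeg_letter_split_zero {i : K} (hi : i ∈ S) {x : H →L[ℂ] H} (hx : x ∈ M i)
    (hc : (1 - P i) * x * (1 - P i) = 0) (ξ : H) :
    leftLeg x (F.split 0 ξ) =
      leftLeg x (F.split 0 (P i ξ)) + F.split 1 ((P i * x * (1 - P i)) ξ) := by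
  have hx' : x = P i * x * (1 - P i) + x * P i + (1 - P i) * x * (1 - P i) := by noncomm_ring
  have h0 : P i ((1 - P i) ξ) = 0 := by
    rw [← mul_apply_eq_comp, mul_sub, hP.mul_self, mul_one, sub_self]; rfl
  have h1 : leftLeg x (F.split 0 ((1 - P i) ξ)) = F.split 1 ((P i * x * (1 - P i)) ξ) := by
    conv_lhs => rw [hx', hc, add_zero, map_add, LinearMap.add_apply, map_mul _ x,
      Module.End.mul_apply, F.leftLeg_proj_split_zero hP, map_zero, add_zero]
    rw [F.leftLeg_split_of_proj_eq_zero hP hi hx h0, ← mul_apply_eq_comp, mul_assoc,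
      hP.compl_mul_self]
  rw [← h1, ← map_add, ← map_add]
  simp

theorem inner_split_succ_succ (X : H →L[ℂ] H) (k l : ℕ) (ξ η : H) :
    ⟪F.split (k + 1) ξ, rightLeg X (F.split (l + 1) η)⟫_ℂ =
      ∑ g, ⟪F.split k (star (F.creation g) ξ),
        rightLeg X (F.split l (star (F.creation g) η))⟫_ℂ := by
  rw [split_succ_apply, sum_inner]
  refine Finset.sum_congr rfl fun g _ => ?_
  rw [inner_leftLeg, leftLeg_rightLeg, F.leftLeg_star_creation_split_succ hP]

theorem inner_split_succ_zero (X : H →L[ℂ] H) (k : ℕ) (ξ η : H) :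
    ⟪F.split (k + 1) ξ, rightLeg X (F.split 0 η)⟫_ℂ = 0 := by
  rw [split_succ_apply, sum_inner]
  refine Finset.sum_eq_zero fun g _ => ?_
  rw [inner_leftLeg, leftLeg_rightLeg, F.leftLeg_star_creation_split_zero hP, map_zero,
    inner_zero_right]

/-- The left legs are words of different lengths. Stripping creations from both sides leaves a
nonempty word against the vacuum space `B Ω`. -/
theorem inner_split_of_ne (X : H →L[ℂ] H) {k l : ℕ} (h : k ≠ l) (ξ η : H) :
    ⟪F.split k ξ, rightLeg X (F.split l η)⟫_ℂ = 0 := by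
  induction k generalizing l ξ η with
  | zero =>
    obtain ⟨l, rfl⟩ := Nat.exists_eq_succ_of_ne_zero h.symm
    have h1 := inner_conj_symm (𝕜 := ℂ) (F.split 0 ξ) (rightLeg X (F.split (l + 1) η))
    have h2 : ⟪rightLeg X (F.split (l + 1) η), F.split 0 ξ⟫_ℂ = 0 := by
      rw [inner_rightLeg, F.inner_split_succ_zero hP]
    refine h1.symm.trans ?_
    rw [h2, map_zero]
  | succ k ih =>
    cases l with
    | zero => exact F.inner_split_succ_zero hP X k ξ η
    | succ l =>
      rw [F.inner_split_succ_succ hP]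
      exact Finset.sum_eq_zero fun g _ => ih (fun e => h (by rw [e])) _ _

omit hP in
theorem inner_split_zero {X : H →L[ℂ] H} (hX : ∀ b, X * β b = β b * X) (ξ η : H) :
    ⟪F.split 0 ξ, rightLeg X (F.split 0 η)⟫_ℂ = ⟪ξ, X η⟫_ℂ := by
  simp only [split_zero_apply, map_sum, rightLeg_tmul]
  exact F.frame_inner X hX ξ η

theorem firstIn_eq_sum : F.firstIn = ∑ g, F.creation g * star (F.creation g) := by
  rw [← Finset.sum_fiberwise_of_maps_to (t := S) fun g _ => F.idx_mem g]
  exact Finset.sum_congr rfl fun i hi => (F.sum_creation hP hi).symm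

/-- A word can be cut after `k + 1` letters exactly when it can be cut after `k` and the rest still
begins in `S`. -/
theorem inner_split_firstIn (k : ℕ) (ξ η : H) :
    ⟪F.split k ξ, rightLeg F.firstIn (F.split k η)⟫_ℂ =
      ⟪F.split (k + 1) ξ, F.split (k + 1) η⟫_ℂ := by
  have h1 : ∀ k ξ η, ⟪F.split k ξ, F.split k η⟫_ℂ =
      ⟪F.split k ξ, rightLeg (1 : H →L[ℂ] H) (F.split k η)⟫_ℂ := fun k ξ η => by
    rw [map_one]; rfl
  induction k generalizing ξ η with
  | zero =>
    rw [F.inner_split_zero (F.firstIn_comm hP), h1, F.inner_split_succ_succ hP,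
      F.firstIn_eq_sum hP, sum_apply, inner_sum]
    refine Finset.sum_congr rfl fun g _ => ?_
    rw [F.inner_split_zero (by simp), mul_apply_eq_comp, ContinuousLinearMap.star_eq_adjoint,
      ← ContinuousLinearMap.adjoint_inner_left]
    rfl
  | succ k ih =>
    rw [F.inner_split_succ_succ hP, h1 (k + 2), F.inner_split_succ_succ hP]
    refine Finset.sum_congr rfl fun g _ => ?_
    rw [ih, h1]

theorem firstIn_mul_self : F.firstIn * F.firstIn = F.firstIn := by
  rw [firstIn, Finset.sum_mul_sum]
  refine Finset.sum_congr rfl fun i hi => ?_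
  rw [Finset.sum_eq_single_of_mem i hi fun j _ hj => hP.orth _ _ hj.symm, hP.mul_self]

theorem star_firstIn : star F.firstIn = F.firstIn := by
  rw [firstIn, star_sum]
  exact Finset.sum_congr rfl fun i _ => hP.star_proj i

/-- A linear combination of the splittings, with coefficients depending on whether the rest of the
word still begins with a letter with index in `S`. -/
def combine (F : LetterFrame β M P Ω S) (a c : ℕ → ℝ) (n : ℕ) : H →ₗ[ℂ] H ⊗[ℂ] H :=
  ∑ k ∈ Finset.range n, (rightLeg ((a k : ℂ) • F.firstIn + (c k : ℂ) • (1 - F.firstIn))).comp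
    (F.split k)

omit hP in
theorem combine_apply (a c : ℕ → ℝ) (n : ℕ) (ξ : H) : F.combine a c n ξ =
    ∑ k ∈ Finset.range n,
      rightLeg ((a k : ℂ) • F.firstIn + (c k : ℂ) • (1 - F.firstIn)) (F.split k ξ) := by
  simp [combine]

/-- Different cuts are orthogonal, and at each cut so are the parts of the right leg inside and
outside the range of `firstIn`. The difference of consecutive squared norms is the mass of the words
whose segment over `S` has length exactly `k`. -/
theorem norm_combine_sq (a c : ℕ → ℝ) (n : ℕ) (ξ : H) :
    ‖F.combine a c n ξ‖ ^ 2 = ∑ k ∈ Finset.range n, (a k ^ 2 * ‖F.split (k + 1) ξ‖ ^ 2 +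
      c k ^ 2 * (‖F.split k ξ‖ ^ 2 - ‖F.split (k + 1) ξ‖ ^ 2)) := by
  have hst : ∀ k, star ((a k : ℂ) • F.firstIn + (c k : ℂ) • (1 - F.firstIn)) =
      (a k : ℂ) • F.firstIn + (c k : ℂ) • (1 - F.firstIn) := fun k => by
    simp [F.star_firstIn hP]
  have hsq : ∀ k, ((a k : ℂ) • F.firstIn + (c k : ℂ) • (1 - F.firstIn)) *
      ((a k : ℂ) • F.firstIn + (c k : ℂ) • (1 - F.firstIn)) =
      ((a k : ℂ) ^ 2 - (c k : ℂ) ^ 2) • F.firstIn + (c k : ℂ) ^ 2 • 1 := fun k => by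
    simp only [mul_add, add_mul, mul_sub, sub_mul, smul_mul_assoc, mul_smul_comm, one_mul, mul_one,
      F.firstIn_mul_self hP, sq]
    module
  have : (‖F.combine a c n ξ‖ ^ 2 : ℂ) = ∑ k ∈ Finset.range n,
      ((a k : ℂ) ^ 2 * (‖F.split (k + 1) ξ‖ : ℂ) ^ 2 +
      (c k : ℂ) ^ 2 * ((‖F.split k ξ‖ : ℂ) ^ 2 - (‖F.split (k + 1) ξ‖ : ℂ) ^ 2)) := by
    have h := inner_self_eq_norm_sq_to_K (𝕜 := ℂ) (F.combine a c n ξ)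
    refine h.symm.trans ?_
    rw [combine_apply, sum_inner]
    refine Finset.sum_congr rfl fun k hk => ?_
    rw [inner_sum, Finset.sum_eq_single_of_mem k hk, inner_rightLeg, hst, ← Module.End.mul_apply,
      ← map_mul, hsq]
    · rw [map_add, map_smul, map_smul, LinearMap.add_apply, LinearMap.smul_apply,
        LinearMap.smul_apply, inner_add_right, inner_smul_right, inner_smul_right,
        F.inner_split_firstIn hP, map_one, Module.End.one_apply]
      have e1 := inner_self_eq_norm_sq_to_K (𝕜 := ℂ) (F.split (k + 1) ξ)
      have e2 := inner_self_eq_norm_sq_to_K (𝕜 := ℂ) (F.split k ξ)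
      rw [e1, e2]
      simp only [Complex.coe_algebraMap]
      ring
    · intro l _ hl
      rw [inner_rightLeg, ← Module.End.mul_apply, ← map_mul, F.inner_split_of_ne hP _ hl.symm]
  exact_mod_cast this

omit hP in
theorem norm_split_zero (ξ : H) : ‖F.split 0 ξ‖ = ‖ξ‖ := by
  have h := F.inner_split_zero (X := 1) (by simp) ξ ξ
  rw [map_one] at h
  have h2 : ⟪F.split 0 ξ, F.split 0 ξ⟫_ℂ = ⟪ξ, ξ⟫_ℂ := h
  have h4 := (inner_self_eq_norm_sq_to_K (𝕜 := ℂ) (F.split 0 ξ)).symm.trans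
    (h2.trans (inner_self_eq_norm_sq_to_K (𝕜 := ℂ) ξ))
  have h3 : ‖F.split 0 ξ‖ ^ 2 = ‖ξ‖ ^ 2 := by exact_mod_cast h4
  exact (sq_eq_sq₀ (norm_nonneg _) (norm_nonneg _)).mp h3

theorem norm_split_succ_le (k : ℕ) (ξ : H) : ‖F.split (k + 1) ξ‖ ≤ ‖F.split k ξ‖ := by
  -- With these weights the squared norm of `combine` is the difference of the two squares to be
  -- compared.
  have h := F.norm_combine_sq hP 0 (Pi.single k 1) (k + 1) ξ
  rw [Finset.sum_eq_single_of_mem k (by simp) fun l _ hl => by simp [Pi.single_eq_of_ne hl]] at h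
  simp only [Pi.zero_apply, Pi.single_eq_same] at h
  have := sq_nonneg ‖F.combine 0 (Pi.single k 1) (k + 1) ξ‖
  exact (sq_le_sq₀ (norm_nonneg _) (norm_nonneg _)).mp (by linarith)

end LetterFrame

end FockEstimate

/-! ### The averaged splitting: rank, isometry and almost intertwining -/

section FockEstimate

variable {B H K : Type*} [DecidableEq K] [CStarAlgebra B] [NormedAddCommGroup H]
  [InnerProductSpace ℂ H] [CompleteSpace H]

/-- `V ξ` is a sum of at most `m` pure tensors, with first legs independent of `ξ`. -/
def HasLegRank (V : H →ₗ[ℂ] H ⊗[ℂ] H) (m : ℕ) : Prop :=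
  ∃ (ι : Type) (_ : Fintype ι) (f : ι → H) (W : ι → H →L[ℂ] H),
    Fintype.card ι ≤ m ∧ ∀ ξ, V ξ = ∑ i, f i ⊗ₜ[ℂ] W i ξ

omit [CompleteSpace H] in
theorem HasLegRank.sum {κ : Type} [DecidableEq κ] (s : Finset κ) {V : κ → H →ₗ[ℂ] H ⊗[ℂ] H}
    {m : κ → ℕ} (h : ∀ k ∈ s, HasLegRank (V k) (m k)) :
    HasLegRank (∑ k ∈ s, V k) (∑ k ∈ s, m k) := by
  choose ι hι f W hm hV using fun k : s => h k.1 k.2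
  refine ⟨Σ k : s, ι k, inferInstance, fun p => f p.1 p.2, fun p => W p.1 p.2, ?_, fun ξ => ?_⟩
  · rw [Fintype.card_sigma, ← Finset.sum_coe_sort s]
    exact Finset.sum_le_sum fun k _ => hm k
  · rw [Fintype.sum_sigma, LinearMap.sum_apply, ← Finset.sum_coe_sort s]
    exact Finset.sum_congr rfl fun k _ => hV k ξ

omit [CompleteSpace H] in
theorem HasLegRank.sandwich {V : H →ₗ[ℂ] H ⊗[ℂ] H} {m : ℕ} (h : HasLegRank V m)
    (S X T : H →L[ℂ] H) :
    HasLegRank ((leftLeg S).comp ((rightLeg X).comp (V.comp T.toLinearMap))) m := by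
  obtain ⟨ι, hι, f, W, hm, hV⟩ := h
  refine ⟨ι, hι, fun i => S (f i), fun i => X ∘L W i ∘L T, hm, fun ξ => ?_⟩
  simp [hV]

/-- The square root of the proportion of `k < N` still to come. -/
def tailWeight (N k : ℕ) : ℝ := √((N - k : ℕ) / N)

/-- `1 / √N` for `k < N`, and zero beyond. -/
def headWeight (N k : ℕ) : ℝ := if k < N then 1 / √N else 0

/-- Every possible cut before `N` consumes mass `1/N`, and `tailWeight` is what is left. The
truncated subtraction makes all weights vanish from `N` on. -/
theorem headWeight_sq (N k : ℕ) (hN : 1 ≤ N) :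
    headWeight N k ^ 2 = tailWeight N k ^ 2 - tailWeight N (k + 1) ^ 2 := by
  have hN' : (0 : ℝ) < N := by exact_mod_cast hN
  rw [tailWeight, tailWeight, Real.sq_sqrt (by positivity), Real.sq_sqrt (by positivity), headWeight]
  split_ifs with h
  · have : N - k = (N - (k + 1)) + 1 := by omega
    rw [this, div_pow, Real.sq_sqrt hN'.le]
    push_cast
    ring
  · have h1 : N - k = 0 := by omega
    have h2 : N - (k + 1) = 0 := by omega
    simp [h1, h2]

theorem sqrt_sub_sqrt_sq_le {x y : ℝ} (hy : 0 ≤ y) (h : y ≤ x) : (√x - √y) ^ 2 ≤ x - y := by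
  have h1 := Real.sqrt_le_sqrt h
  have h2 := Real.sqrt_nonneg y
  have h3 := Real.sq_sqrt hy
  have h4 := Real.sq_sqrt (hy.trans h)
  nlinarith

theorem tailWeight_sub_sq_le (N k : ℕ) : (tailWeight N k - tailWeight N (k + 1)) ^ 2 ≤ 1 / N := by
  refine (sqrt_sub_sqrt_sq_le (by positivity) ?_).trans ?_
  · gcongr
    omega
  · rw [← sub_div]
    gcongr
    have : ((N - k : ℕ) : ℝ) ≤ (N - (k + 1) : ℕ) + 1 := by
      exact_mod_cast (show N - k ≤ (N - (k + 1)) + 1 by omega)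
    linarith

namespace LetterFrame

variable {β : B →⋆ₐ[ℂ] (H →L[ℂ] H)} {M : K → StarSubalgebra ℂ (H →L[ℂ] H)}
  {P : K → H →L[ℂ] H} {Ω : H} {S : Finset K} (F : LetterFrame β M P Ω S)

theorem hasLegRank_split (k : ℕ) :
    HasLegRank (F.split k) (Fintype.card F.R * Fintype.card F.G ^ k) := by
  classical
  induction k with
  | zero =>
    exact ⟨F.R, inferInstance, fun s => β (F.r s) Ω, fun s => star (β (F.r s)), by simp,
      F.split_zero_apply⟩
  | succ k ih =>
    have h := HasLegRank.sum Finset.univ (m := fun _ => Fintype.card F.R * Fintype.card F.G ^ k)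
      fun g _ => ih.sandwich (F.creation g) 1 (star (F.creation g))
    rw [Finset.sum_const, Finset.card_univ, smul_eq_mul] at h
    convert h using 1
    · simp only [map_one]
      rfl
    · ring

/-- The right leg weights do not affect the first legs, so the ranks of the splittings add up. The
base `card G + 1` makes the powers monotone even when there are no letters. -/
theorem hasLegRank_combine (a c : ℕ → ℝ) (n : ℕ) :
    HasLegRank (F.combine a c n) (n * (Fintype.card F.R * (Fintype.card F.G + 1) ^ n)) := by
  have h := HasLegRank.sum (Finset.range n) fun k _ => (F.hasLegRank_split k).sandwich 1
    ((a k : ℂ) • F.firstIn + (c k : ℂ) • (1 - F.firstIn)) 1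
  obtain ⟨ι, hι, f, W, hm, hV⟩ := h
  refine ⟨ι, hι, f, W, hm.trans ?_, fun ξ => ?_⟩
  · refine (Finset.sum_le_card_nsmul _ _ (Fintype.card F.R * (Fintype.card F.G + 1) ^ n)
      fun k hk => ?_).trans (by simp)
    have hk' := Finset.mem_range.mp hk
    exact Nat.mul_le_mul_left _ ((Nat.pow_le_pow_left (Nat.le_succ _) k).trans
      (Nat.pow_le_pow_right (Nat.succ_pos _) hk'.le))
  · rw [← hV, combine_apply]
    simp

/-- Splitting off a random initial segment. -/
def splitMean (N : ℕ) : H →ₗ[ℂ] H ⊗[ℂ] H := F.combine (headWeight N) (tailWeight N) (N + 1)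

variable (hP : FreeCompression β M P Ω)
include hP

/-- By `headWeight_sq` the sum for the squared norm telescopes, from the full mass at `0` to a
vanishing tail weight. -/
theorem norm_splitMean {N : ℕ} (hN : 1 ≤ N) (ξ : H) : ‖F.splitMean N ξ‖ = ‖ξ‖ := by
  have hN' : (N : ℝ) ≠ 0 := by positivity
  have h : ‖F.splitMean N ξ‖ ^ 2 = ‖ξ‖ ^ 2 := by
    rw [splitMean, F.norm_combine_sq hP]
    have h1 : ∀ k ∈ Finset.range (N + 1), headWeight N k ^ 2 * ‖F.split (k + 1) ξ‖ ^ 2 +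
        tailWeight N k ^ 2 * (‖F.split k ξ‖ ^ 2 - ‖F.split (k + 1) ξ‖ ^ 2) =
        tailWeight N k ^ 2 * ‖F.split k ξ‖ ^ 2 -
          tailWeight N (k + 1) ^ 2 * ‖F.split (k + 1) ξ‖ ^ 2 := fun k _ => by
      rw [headWeight_sq N k hN]
      ring
    rw [Finset.sum_congr rfl h1,
      Finset.sum_range_sub' (fun k => tailWeight N k ^ 2 * ‖F.split k ξ‖ ^ 2), F.norm_split_zero]
    simp [tailWeight, div_self hN']
  exact (sq_eq_sq₀ (norm_nonneg _) (norm_nonneg _)).mp h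

/-- Bound for differences of consecutive weights: `headWeight` jumps only once, while the increments
of `tailWeight` are uniformly small and are summed against a telescoping mass. No factor of the
number of cuts is lost. -/
theorem norm_combine_le {a c : ℕ → ℝ} {t : ℝ} (ht : 0 ≤ t) {m : ℕ} (ha0 : ∀ k, k ≠ m → a k = 0)
    (ha : a m ^ 2 ≤ t ^ 2) (hc : ∀ k, c k ^ 2 ≤ t ^ 2) (n : ℕ) (ξ : H) :
    ‖F.combine a c n ξ‖ ≤ 3 / 2 * t * ‖ξ‖ := by
  have hmono : Antitone fun k => ‖F.split k ξ‖ ^ 2 := antitone_nat_of_succ_le fun k => by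
    have := F.norm_split_succ_le hP k ξ
    gcongr
  have h0 : ∀ k, ‖F.split k ξ‖ ^ 2 ≤ ‖ξ‖ ^ 2 := fun k => by
    have := hmono (Nat.zero_le k)
    simpa [F.norm_split_zero] using this
  have h1 : ∑ k ∈ Finset.range n, a k ^ 2 * ‖F.split (k + 1) ξ‖ ^ 2 ≤ t ^ 2 * ‖ξ‖ ^ 2 := by
    have : ∀ k ∈ Finset.range n, a k ^ 2 * ‖F.split (k + 1) ξ‖ ^ 2 ≤
        if k = m then t ^ 2 * ‖ξ‖ ^ 2 else 0 := fun k _ => by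
      split_ifs with h
      · subst h
        exact mul_le_mul ha (h0 _) (by positivity) (by positivity)
      · simp [ha0 k h]
    refine (Finset.sum_le_sum this).trans ?_
    rw [Finset.sum_ite_eq']
    split_ifs
    · exact le_rfl
    · positivity
  have h2 : ∑ k ∈ Finset.range n, c k ^ 2 * (‖F.split k ξ‖ ^ 2 - ‖F.split (k + 1) ξ‖ ^ 2) ≤
      t ^ 2 * ‖ξ‖ ^ 2 := by
    refine (Finset.sum_le_sum fun k _ => mul_le_mul_of_nonneg_right (hc k)
      (sub_nonneg.mpr (hmono (Nat.le_succ k)))).trans ?_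
    rw [← Finset.mul_sum, Finset.sum_range_sub' fun k => ‖F.split k ξ‖ ^ 2, F.norm_split_zero]
    have := sq_nonneg ‖F.split n ξ‖
    gcongr
    linarith
  have h3 := F.norm_combine_sq hP a c n ξ
  rw [Finset.sum_add_distrib] at h3
  -- The two sums give `2 t²‖ξ‖²`, and `2 ≤ (3/2)²`.
  refine abs_le_of_sq_le_sq' ?_ (by positivity) |>.2
  nlinarith [mul_nonneg (sq_nonneg t) (sq_nonneg ‖ξ‖)]

omit hP in
theorem rightLeg_split_zero {X : H →L[ℂ] H} (hX : ∀ b, X * β b = β b * X) (ξ : H) :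
    rightLeg X (F.split 0 ξ) = F.split 0 (X ξ) := by
  simp only [split_zero_apply, map_sum, rightLeg_tmul, ← map_star, ← mul_apply_eq_comp, hX]

theorem firstIn_proj {i : K} (hi : i ∈ S) (ξ : H) : F.firstIn (P i ξ) = P i ξ := by
  rw [firstIn, sum_apply, Finset.sum_eq_single_of_mem i hi, ← mul_apply_eq_comp, hP.mul_self]
  intro j _ hj
  rw [← mul_apply_eq_comp, hP.orth _ _ hj]
  rfl

theorem rightLeg_weight_split_zero {i : K} (hi : i ∈ S) (a c : ℂ) (ξ : H) :
    rightLeg (a • F.firstIn + c • (1 - F.firstIn)) (F.split 0 (P i ξ)) =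
      a • F.split 0 (P i ξ) := by
  rw [F.rightLeg_split_zero, ← map_smul]
  · congr 1
    simp [F.firstIn_proj hP hi]
  · intro b
    simp only [add_mul, mul_add, sub_mul, mul_sub, smul_mul_assoc, mul_smul_comm,
      F.firstIn_comm hP, one_mul, mul_one]

theorem leftLeg_incl_splitMean (N : ℕ) (b : B) (ξ : H) :
    leftLeg (β b) (F.splitMean N ξ) = F.splitMean N (β b ξ) := by
  simp only [splitMean, combine_apply, map_sum, leftLeg_rightLeg, F.leftLeg_incl_split hP]

omit [DecidableEq K] in
theorem _root_.FreeCompression.norm_proj_le (i : K) (ξ : H) : ‖P i ξ‖ ≤ ‖ξ‖ := by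
  have h : IsStarProjection (P i) := ⟨hP.mul_self i, hP.star_proj i⟩
  exact ((P i).le_opNorm ξ).trans (mul_le_of_le_one_left (norm_nonneg _) h.norm_le)

omit [DecidableEq K] in
theorem _root_.FreeCompression.norm_compl_le (i : K) (ξ : H) : ‖(1 - P i) ξ‖ ≤ ‖ξ‖ := by
  have h : IsStarProjection (1 - P i) := ⟨hP.compl_mul_self i, hP.star_compl i⟩
  exact ((1 - P i).le_opNorm ξ).trans (mul_le_of_le_one_left (norm_nonneg _) h.norm_le)

/-- The preserving part cancels except at the cut `0`. The creation and annihilation parts shift the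
cut by one, so they leave weight differences; the two remaining terms are boundary errors at the cut
`0`. -/
theorem leftLeg_splitMean_sub {N : ℕ} {i : K} (hi : i ∈ S) {x : H →L[ℂ] H} (hx : x ∈ M i)
    (hc : (1 - P i) * x * (1 - P i) = 0) (ξ : H) :
    leftLeg x (F.splitMean N ξ) - F.splitMean N (x ξ) =
      (headWeight N 0 : ℂ) • leftLeg x (F.split 0 (P i ξ)) +
      F.combine (fun k => k.casesOn 0 fun k => headWeight N k - headWeight N (k + 1))
        (fun k => k.casesOn 0 fun k => tailWeight N k - tailWeight N (k + 1)) (N + 2)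
        ((P i * x * (1 - P i)) ξ) +
      F.combine (fun k => headWeight N (k + 1) - headWeight N k)
        (fun k => tailWeight N (k + 1) - tailWeight N k) (N + 1) (((1 - P i) * x * P i) ξ) -
      (headWeight N 0 : ℂ) • F.split 0 (P i (x ξ)) := by
  set η := (P i * x * (1 - P i)) ξ with hη
  set d := (P i * x * P i) ξ with hd
  set ζ := ((1 - P i) * x * P i) ξ with hζ
  have hxξ : x ξ = η + d + ζ := by
    have hx' : x = P i * x * (1 - P i) + P i * x * P i + (1 - P i) * x * P i +
      (1 - P i) * x * (1 - P i) := by noncomm_ring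
    conv_lhs => rw [hx', hc]
    simp only [add_apply, add_zero, hη, hd, hζ]
  have hPx : P i (x ξ) = η + d := by
    rw [hη, hd, ← add_apply, ← mul_add, sub_add_cancel, mul_one]; rfl
  set Γ : ℕ → H →L[ℂ] H := fun k =>
    (headWeight N k : ℂ) • F.firstIn + (tailWeight N k : ℂ) • (1 - F.firstIn) with hΓ
  have hΓ0 : ∀ k, N ≤ k → Γ k = 0 := fun k hk => by
    have h1 : headWeight N k = 0 := if_neg (by omega)
    have h2 : tailWeight N k = 0 := by
      have : N - k = 0 := by omega
      simp [tailWeight, this]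
    simp [hΓ, h1, h2]
  have hmean : ∀ ξ, F.splitMean N ξ = ∑ k ∈ Finset.range (N + 1), rightLeg (Γ k) (F.split k ξ) :=
    F.combine_apply _ _ _
  have h0 : (headWeight N 0 : ℂ) • F.split 0 (P i (x ξ)) = rightLeg (Γ 0) (F.split 0 (η + d)) := by
    rw [← hPx, F.rightLeg_weight_split_zero hP hi]
  have h0' : (headWeight N 0 : ℂ) • leftLeg x (F.split 0 (P i ξ)) =
      rightLeg (Γ 0) (leftLeg x (F.split 0 (P i ξ))) := by
    rw [← leftLeg_rightLeg, F.rightLeg_weight_split_zero hP hi, map_smul]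
  have h1 : F.combine (fun k => headWeight N (k + 1) - headWeight N k)
        (fun k => tailWeight N (k + 1) - tailWeight N k) (N + 1) ζ =
      ∑ k ∈ Finset.range (N + 1), (rightLeg (Γ (k + 1)) (F.split k ζ) -
        rightLeg (Γ k) (F.split k ζ)) := by
    rw [combine_apply]
    refine Finset.sum_congr rfl fun k _ => ?_
    rw [← LinearMap.sub_apply, ← map_sub]
    congr 2
    simp only [hΓ, Complex.ofReal_sub]
    module
  have h2 : F.combine (fun k => k.casesOn 0 fun k => headWeight N k - headWeight N (k + 1))
        (fun k => k.casesOn 0 fun k => tailWeight N k - tailWeight N (k + 1)) (N + 2) η =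
      ∑ k ∈ Finset.range (N + 1), (rightLeg (Γ k) (F.split (k + 1) η) -
        rightLeg (Γ (k + 1)) (F.split (k + 1) η)) := by
    -- A created word has at least one letter in the left leg; the zero weights at index `0` remove
    -- the summand without one.
    rw [combine_apply, Finset.sum_range_succ']
    have hz : rightLeg (((0 : ℝ) : ℂ) • F.firstIn + ((0 : ℝ) : ℂ) • (1 - F.firstIn))
        (F.split 0 η) = 0 := by simp
    refine (congrArg₂ (· + ·) rfl hz).trans ((add_zero _).trans ?_)
    refine Finset.sum_congr rfl fun k _ => ?_
    rw [← LinearMap.sub_apply, ← map_sub]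
    congr 2
    simp only [hΓ, Complex.ofReal_sub]
    module
  rw [h0, h0', h1, h2, hmean, hmean, map_sum]
  have hL : ∑ k ∈ Finset.range (N + 1), leftLeg x (rightLeg (Γ k) (F.split k ξ)) =
      rightLeg (Γ 0) (leftLeg x (F.split 0 (P i ξ))) + rightLeg (Γ 0) (F.split 1 η) +
      ∑ k ∈ Finset.range N, (rightLeg (Γ (k + 1)) (F.split (k + 2) η) +
        rightLeg (Γ (k + 1)) (F.split (k + 1) d) + rightLeg (Γ (k + 1)) (F.split k ζ)) := by
    rw [Finset.sum_range_succ', add_comm]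
    simp only [leftLeg_rightLeg]
    rw [F.leftLeg_letter_split_zero hP hi hx hc, map_add]
    congr 1
    refine Finset.sum_congr rfl fun k _ => ?_
    rw [F.leftLeg_letter_split_succ hP hi hx hc, map_add, map_add]
  have e1 : ∑ k ∈ Finset.range (N + 1), rightLeg (Γ k) (F.split (k + 1) η) =
      ∑ k ∈ Finset.range N, rightLeg (Γ (k + 1)) (F.split (k + 2) η) +
        rightLeg (Γ 0) (F.split 1 η) := Finset.sum_range_succ' _ _
  have e2 : ∀ v, ∑ k ∈ Finset.range (N + 1), rightLeg (Γ k) (F.split k v) =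
      ∑ k ∈ Finset.range N, rightLeg (Γ (k + 1)) (F.split (k + 1) v) +
        rightLeg (Γ 0) (F.split 0 v) := fun v => Finset.sum_range_succ' _ _
  have e3 : ∑ k ∈ Finset.range (N + 1), rightLeg (Γ (k + 1)) (F.split k ζ) =
      ∑ k ∈ Finset.range N, rightLeg (Γ (k + 1)) (F.split k ζ) := by
    rw [Finset.sum_range_succ, hΓ0 (N + 1) (Nat.le_succ N)]
    simp
  have e4 : ∑ k ∈ Finset.range (N + 1), rightLeg (Γ (k + 1)) (F.split (k + 1) η) =
      ∑ k ∈ Finset.range N, rightLeg (Γ (k + 1)) (F.split (k + 1) η) := by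
    rw [Finset.sum_range_succ, hΓ0 (N + 1) (Nat.le_succ N)]
    simp
  have e5 := e2 ζ
  rw [hL, hxξ]
  simp only [map_add, Finset.sum_add_distrib, Finset.sum_sub_distrib]
  rw [e1, e2 η, e2 d, e3, e4]
  abel

/-- The constant is `1 + 1` from the two boundary terms and `3/2 + 3/2` from the two weight
differences. -/
theorem norm_leftLeg_splitMean_sub_le {N : ℕ} (hN : 1 ≤ N) {i : K} (hi : i ∈ S) {x : H →L[ℂ] H}
    (hx : x ∈ M i) (hc : (1 - P i) * x * (1 - P i) = 0) (ξ : H) :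
    ‖leftLeg x (F.splitMean N ξ) - F.splitMean N (x ξ)‖ ≤ 5 * (1 / √N) * ‖x‖ * ‖ξ‖ := by
  set t : ℝ := 1 / √N with ht
  have ht0 : 0 ≤ t := by positivity
  have ht2 : t ^ 2 = 1 / N := by rw [ht, div_pow, Real.sq_sqrt (by positivity), one_pow]
  have hw0 : headWeight N 0 = t := if_pos hN
  have hw : ∀ k, k ≠ N - 1 → headWeight N k - headWeight N (k + 1) = 0 := fun k hk => by
    unfold headWeight
    split_ifs <;> first | omega | simp
  have hw1 : (headWeight N (N - 1) - headWeight N (N - 1 + 1)) ^ 2 ≤ t ^ 2 := by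
    rw [headWeight, headWeight, if_pos (by omega), if_neg (by omega), sub_zero]
  have hT : ∀ k, (tailWeight N k - tailWeight N (k + 1)) ^ 2 ≤ t ^ 2 := fun k => by
    rw [ht2]; exact tailWeight_sub_sq_le N k
  have nP := hP.norm_proj_le i
  have nQ := hP.norm_compl_le i
  have nx := x.le_opNorm
  have b1 : ‖(headWeight N 0 : ℂ) • leftLeg x (F.split 0 (P i ξ))‖ ≤ t * (‖x‖ * ‖ξ‖) := by
    rw [norm_smul, hw0, Complex.norm_real, Real.norm_of_nonneg ht0]
    refine mul_le_mul_of_nonneg_left ((norm_leftLeg_le x _).trans ?_) ht0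
    rw [F.norm_split_zero]
    exact mul_le_mul_of_nonneg_left (nP ξ) (norm_nonneg x)
  have b2 : ‖(headWeight N 0 : ℂ) • F.split 0 (P i (x ξ))‖ ≤ t * (‖x‖ * ‖ξ‖) := by
    rw [norm_smul, hw0, Complex.norm_real, Real.norm_of_nonneg ht0, F.norm_split_zero]
    exact mul_le_mul_of_nonneg_left ((nP _).trans (nx ξ)) ht0
  have b3 := F.norm_combine_le hP (a := fun k => headWeight N (k + 1) - headWeight N k)
    (c := fun k => tailWeight N (k + 1) - tailWeight N k) ht0 (m := N - 1)
    (fun k hk => by have := hw k hk; linarith)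
    (by rw [← neg_sub, neg_sq]; exact hw1)
    (fun k => by rw [← neg_sub, neg_sq]; exact hT k) (N + 1) (((1 - P i) * x * P i) ξ)
  have b4 := F.norm_combine_le hP
    (a := fun k => k.casesOn 0 fun k => headWeight N k - headWeight N (k + 1))
    (c := fun k => k.casesOn 0 fun k => tailWeight N k - tailWeight N (k + 1)) ht0
    (m := N - 1 + 1)
    (fun k hk => by
      cases k with
      | zero => rfl
      | succ k => exact hw k fun h => hk (by rw [h]))
    hw1
    (fun k => by
      cases k with
      | zero => simpa using sq_nonneg t
      | succ k => exact hT k) (N + 2) ((P i * x * (1 - P i)) ξ)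
  have b5 : ‖((1 - P i) * x * P i) ξ‖ ≤ ‖x‖ * ‖ξ‖ :=
    (nQ _).trans ((nx _).trans (mul_le_mul_of_nonneg_left (nP ξ) (norm_nonneg x)))
  have b6 : ‖(P i * x * (1 - P i)) ξ‖ ≤ ‖x‖ * ‖ξ‖ :=
    (nP _).trans ((nx _).trans (mul_le_mul_of_nonneg_left (nQ ξ) (norm_nonneg x)))
  rw [F.leftLeg_splitMean_sub hP hi hx hc]
  refine (norm_sub_le _ _).trans ?_
  refine (add_le_add ((norm_add_le _ _).trans
    (add_le_add ((norm_add_le _ _).trans (add_le_add b1 b4)) b3)) b2).trans ?_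
  have b7 := mul_le_mul_of_nonneg_left b5 (show 0 ≤ 3 / 2 * t by positivity)
  have b8 := mul_le_mul_of_nonneg_left b6 (show 0 ≤ 3 / 2 * t by positivity)
  linarith

end LetterFrame

end FockEstimate

end

noncomputable section

open scoped InnerProductSpace ComplexOrder TensorProduct
open InnerProductSpace

/-! ### The regular trace of a finite dimensional C⋆-algebra -/

section RegularTrace

variable {B : Type*} [CStarAlgebra B]

/-- The trace of left multiplication. -/
def regularTrace (B : Type*) [CStarAlgebra B] : B →ₗ[ℂ] ℂ :=
  (LinearMap.trace ℂ B).comp (Algebra.lmul ℂ B).toLinearMap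

theorem regularTrace_mul_comm (a b : B) : regularTrace B (a * b) = regularTrace B (b * a) := by
  simp only [regularTrace, LinearMap.comp_apply, AlgHom.toLinearMap_apply, map_mul]
  exact LinearMap.trace_mul_comm ℂ _ _

variable [FiniteDimensional ℂ B]

omit [FiniteDimensional ℂ B] in
-- This turns positivity of `a` into nonnegativity of the eigenvalues whose sum is the trace, which
-- gives positivity and faithfulness of `regularTrace`.
theorem spectrum_lmul (a : B) : spectrum ℂ (Algebra.lmul ℂ B a) = spectrum ℂ a := by
  refine Set.Subset.antisymm (AlgHom.spectrum_apply_subset (Algebra.lmul ℂ B) a) fun z hz h => hz ?_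
  rw [spectrum.mem_resolventSet_iff, ← Algebra.lmul_isUnit_iff (R := ℂ), map_sub, AlgHom.commutes]
  exact h

theorem regularTrace_eq_sum (a : B) :
    regularTrace B a = (LinearMap.charpoly (Algebra.lmul ℂ B a)).roots.sum :=
  Module.End.trace_eq_sum_roots_charpoly_of_splits (IsAlgClosed.splits _)

variable [PartialOrder B] [StarOrderedRing B]

theorem nonneg_of_mem_roots {a : B} (ha : 0 ≤ a) {z : ℂ}
    (hz : z ∈ (LinearMap.charpoly (Algebra.lmul ℂ B a)).roots) : 0 ≤ z := by
  have h := (Module.End.mem_spectrum_iff_isRoot_charpoly _ z).mpr (Polynomial.isRoot_of_mem_roots hz)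
  rw [spectrum_lmul] at h
  exact spectrum_nonneg_of_nonneg ha h

theorem regularTrace_nonneg {a : B} (ha : 0 ≤ a) : 0 ≤ regularTrace B a := by
  rw [regularTrace_eq_sum]
  exact Multiset.sum_nonneg fun z hz => nonneg_of_mem_roots ha hz

theorem eq_zero_of_regularTrace_eq_zero {a : B} (ha : 0 ≤ a) (h : regularTrace B a = 0) : a = 0 := by
  rw [regularTrace_eq_sum] at h
  have hs : spectralRadius ℂ a = 0 := by
    refine iSup₂_eq_bot.mpr fun z hz => ?_
    rw [← spectrum_lmul, Module.End.mem_spectrum_iff_isRoot_charpoly,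
      ← Polynomial.mem_roots (LinearMap.charpoly_monic _).ne_zero] at hz
    have h1 := Multiset.single_le_sum (fun z hz => nonneg_of_mem_roots ha hz) z hz
    rw [h] at h1
    simp [le_antisymm h1 (nonneg_of_mem_roots ha hz)]
  rw [(IsSelfAdjoint.of_nonneg ha).spectralRadius_eq_nnnorm] at hs
  simpa using hs

/-- The regular trace, as a positive functional. -/
def regularTracePos (B : Type*) [CStarAlgebra B] [FiniteDimensional ℂ B] [PartialOrder B]
    [StarOrderedRing B] : B →ₚ[ℂ] ℂ :=
  PositiveLinearMap.mk₀ (regularTrace B) fun _ ha => regularTrace_nonneg ha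

theorem regularTrace_star (a : B) : regularTrace B (star a) = star (regularTrace B a) :=
  map_star (regularTracePos B) a

/-- An orthonormal basis of `B` for the inner product `τ(a⋆b)`, which is definite because the trace
is faithful. -/
theorem exists_trace_basis : ∃ (n : ℕ) (r : Fin n → B),
    (∀ c, ∑ s, regularTrace B (star (r s) * c) • r s = c) := by
  let j : B →ₗ[ℂ] (regularTracePos B).GNS :=
    (UniformSpace.Completion.toComplL (𝕜 := ℂ)).toLinearMap.comp
      (regularTracePos B).toPreGNS.toLinearMap
  have hj : ∀ a b, ⟪j a, j b⟫_ℂ = regularTrace B (star a * b) := fun a b =>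
    UniformSpace.Completion.inner_coe _ _
  have hinj : Function.Injective j := by
    refine (injective_iff_map_eq_zero j).mpr fun a ha => ?_
    have h := hj a a
    rw [ha, inner_zero_left] at h
    exact (CStarRing.star_mul_self_eq_zero_iff a).mp
      (eq_zero_of_regularTrace_eq_zero (star_mul_self_nonneg a) h.symm)
  let e := LinearEquiv.ofInjective j hinj
  let b := stdOrthonormalBasis ℂ (LinearMap.range j)
  refine ⟨_, fun s => e.symm (b s), fun c => e.injective ?_⟩
  rw [map_sum]
  conv_rhs => rw [← b.sum_repr (e c)]
  refine Finset.sum_congr rfl fun s _ => ?_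
  rw [map_smul, e.apply_symm_apply, b.repr_apply_apply]
  congr 1
  rw [← hj, Submodule.coe_inner]
  congr 1
  exact congrArg Subtype.val (e.apply_symm_apply (b s))

theorem eq_of_regularTrace_mul_eq {a b : B}
    (h : ∀ c, regularTrace B (c * a) = regularTrace B (c * b)) : a = b := by
  have h1 := h (star (a - b))
  rw [← sub_eq_zero, ← map_sub, ← mul_sub] at h1
  exact sub_eq_zero.mp ((CStarRing.star_mul_self_eq_zero_iff _).mp
    (eq_zero_of_regularTrace_eq_zero (star_mul_self_nonneg _) h1))

variable {n : ℕ} {r : Fin n → B} (hr : ∀ c, ∑ s, regularTrace B (star (r s) * c) • r s = c)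
include hr

theorem trace_basis_star (c : B) : ∑ s, regularTrace B (r s * c) • star (r s) = c := by
  have h := congrArg star (hr (star c))
  rw [star_star, star_sum] at h
  conv_rhs => rw [← h]
  refine Finset.sum_congr rfl fun s _ => ?_
  rw [star_smul, ← regularTrace_star, star_mul, star_star, star_star, regularTrace_mul_comm]

omit [PartialOrder B] [StarOrderedRing B] hr in
-- The trace of left multiplication is computed in the given dual bases. This is specific to the
-- regular trace among the faithful traces.
theorem regularTrace_eq_of_expansion {u v : Fin n → B}
    (h : ∀ c, ∑ s, regularTrace B (u s * c) • v s = c) (c : B) :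
    regularTrace B c = ∑ s, regularTrace B (u s * c * v s) := by
  have : Algebra.lmul ℂ B c = ∑ s,
      ((regularTrace B).comp (LinearMap.mulLeft ℂ (u s * c))).smulRight (v s) := by
    refine LinearMap.ext fun x => ?_
    conv_lhs => rw [← h (Algebra.lmul ℂ B c x)]
    simp [LinearMap.sum_apply]
  conv_lhs => rw [regularTrace, LinearMap.comp_apply, AlgHom.toLinearMap_apply, this, map_sum]
  refine Finset.sum_congr rfl fun s _ => ?_
  rw [LinearMap.trace_smulRight]
  simp [mul_assoc]

/-- By the trace formula, `τ(c) = ∑ τ(rₛ⋆ c rₛ) = τ(c ∑ rₛ rₛ⋆)` for all `c`, and the trace form is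
nondegenerate. -/
theorem sum_trace_basis_mul_star : ∑ s, r s * star (r s) = 1 := by
  refine eq_of_regularTrace_mul_eq (B := B) fun c => ?_
  rw [mul_one, Finset.mul_sum, map_sum, regularTrace_eq_of_expansion hr]
  refine Finset.sum_congr rfl fun s _ => ?_
  rw [← mul_assoc, regularTrace_mul_comm, mul_assoc]

theorem sum_star_trace_basis_mul : ∑ s, star (r s) * r s = 1 := by
  refine eq_of_regularTrace_mul_eq (B := B) fun c => ?_
  rw [mul_one, Finset.mul_sum, map_sum, regularTrace_eq_of_expansion (trace_basis_star hr)]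
  refine Finset.sum_congr rfl fun s _ => ?_
  rw [← mul_assoc, regularTrace_mul_comm, mul_assoc]

end RegularTrace

/-! ### Words of centred letters -/

namespace CondExp

variable {B A : Type*} [CStarAlgebra B] [PartialOrder B] [StarOrderedRing B] [CStarAlgebra A]
  (φ : CondExp B A)

theorem exp_incl_mul (b : B) (a : A) : φ.exp (φ.incl b * a) = b * φ.exp a := by
  simpa using φ.exp_bimodule b a 1

theorem exp_mul_incl (a : A) (b : B) : φ.exp (a * φ.incl b) = φ.exp a * b := by
  simpa using φ.exp_bimodule 1 a b

theorem exp_star (a : A) : φ.exp (star a) = star (φ.exp a) := by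
  let := CStarAlgebra.spectralOrder A
  let := CStarAlgebra.spectralOrderedRing A
  let f : A →ₚ[ℂ] B := PositiveLinearMap.mk₀ φ.exp fun x hx => by
    obtain ⟨y, rfl⟩ := CStarAlgebra.nonneg_iff_eq_star_mul_self.mp hx
    exact φ.exp_nonneg y
  exact map_star f a

/-- The part of `a` in the kernel of the conditional expectation. -/
def centre (a : A) : A := a - φ.incl (φ.exp a)

theorem exp_centre (a : A) : φ.exp (φ.centre a) = 0 := by
  rw [centre, map_sub, φ.exp_incl, sub_self]

theorem incl_add_centre (a : A) : φ.incl (φ.exp a) + φ.centre a = a := by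
  rw [centre, add_sub_cancel]

end CondExp

section Words

variable {B K : Type*} [CStarAlgebra B] [PartialOrder B] [StarOrderedRing B] {Ai : K → Type*}
  [∀ i, CStarAlgebra (Ai i)] (E : ∀ i, CondExp B (Ai i))

/-- Lists of centred letters with different neighbouring indices. -/
def IsAlternating (l : List (Σ i, Ai i)) : Prop :=
  l.IsChain (fun p q => p.1 ≠ q.1) ∧ ∀ p ∈ l, (E p.1).exp p.2 = 0

/-- `i` is not the index of the first letter. -/
def HeadNe (i : K) (l : List (Σ i, Ai i)) : Prop := ∀ p ∈ l.head?, i ≠ p.1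

variable {E}

theorem isAlternating_nil : IsAlternating E ([] : List (Σ i, Ai i)) := ⟨List.IsChain.nil, by simp⟩

theorem isAlternating_cons {i : K} {x : Ai i} {l : List (Σ i, Ai i)} :
    IsAlternating E (⟨i, x⟩ :: l) ↔ (E i).exp x = 0 ∧ HeadNe i l ∧ IsAlternating E l := by
  simp only [IsAlternating, HeadNe, List.isChain_cons, List.forall_mem_cons]
  tauto

theorem headNe_cons {i : K} {p : Σ i, Ai i} {l : List (Σ i, Ai i)} :
    HeadNe i (p :: l) ↔ i ≠ p.1 := by simp [HeadNe]

section Ring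

variable {R : Type*} [Ring R] [Algebra ℂ R] (emb : ∀ i, Ai i →ₐ[ℂ] R) (incl : B →ₐ[ℂ] R)

/-- The product of the letters of `l`, followed by an element of `B`. -/
def wordVal (l : List (Σ i, Ai i)) (b : B) : R := (l.map fun p => emb p.1 p.2).prod * incl b

variable {emb incl} (h : ∀ i b, emb i ((E i).incl b) = incl b)

theorem wordVal_cons (p : Σ i, Ai i) (l : List (Σ i, Ai i)) (b : B) :
    wordVal emb incl (p :: l) b = emb p.1 p.2 * wordVal emb incl l b := by
  simp [wordVal, mul_assoc]

include h

theorem incl_mul_wordVal (c : B) {l : List (Σ i, Ai i)} (hl : IsAlternating E l) (b : B) :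
    ∃ l' b', IsAlternating E l' ∧ l'.map Sigma.fst = l.map Sigma.fst ∧
      incl c * wordVal emb incl l b = wordVal emb incl l' b' := by
  cases l with
  | nil => exact ⟨[], c * b, hl, rfl, by simp [wordVal]⟩
  | cons p l =>
    obtain ⟨i, x⟩ := p
    obtain ⟨hx, hh, hl⟩ := isAlternating_cons.mp hl
    refine ⟨⟨i, (E i).incl c * x⟩ :: l, b, isAlternating_cons.mpr ⟨?_, hh, hl⟩, rfl, ?_⟩
    · rw [(E i).exp_incl_mul, hx, mul_zero]
    · rw [wordVal_cons, wordVal_cons, map_mul, h, mul_assoc]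

omit h in
theorem headNe_of_map_eq {i : K} {l l' : List (Σ i, Ai i)}
    (hll : l'.map Sigma.fst = l.map Sigma.fst) : HeadNe i l' ↔ HeadNe i l := by
  cases l <;> cases l' <;> simp_all [HeadNe]

variable (E emb incl) in
omit h in
/-- The span of the words of centred letters. -/
def wordSpan : Submodule ℂ R :=
  Submodule.span ℂ {w | ∃ l b, IsAlternating E l ∧ w = wordVal emb incl l b}

omit h in
theorem wordVal_mem_wordSpan {l : List (Σ i, Ai i)} (hl : IsAlternating E l) (b : B) :
    wordVal emb incl l b ∈ wordSpan E emb incl :=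
  Submodule.subset_span ⟨l, b, hl, rfl⟩

theorem incl_mul_mem_wordSpan (c : B) {l : List (Σ i, Ai i)} (hl : IsAlternating E l) (b : B) :
    incl c * wordVal emb incl l b ∈ wordSpan E emb incl := by
  obtain ⟨l', b', hl', -, e⟩ := incl_mul_wordVal h c hl b
  exact e ▸ wordVal_mem_wordSpan hl' b'

theorem letter_mul_wordVal {i : K} (y : Ai i) (l : List (Σ i, Ai i)) (b : B) :
    emb i y * wordVal emb incl l b = incl ((E i).exp y) * wordVal emb incl l b +
      wordVal emb incl (⟨i, (E i).centre y⟩ :: l) b := by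
  conv_lhs => rw [← (E i).incl_add_centre y, map_add, h, add_mul]
  rw [wordVal_cons]

theorem letter_mul_wordVal_cons {i : K} (y x : Ai i) (l : List (Σ i, Ai i)) (b : B) :
    emb i y * wordVal emb incl (⟨i, x⟩ :: l) b =
      incl ((E i).exp (y * x)) * wordVal emb incl l b +
      wordVal emb incl (⟨i, (E i).centre (y * x)⟩ :: l) b := by
  rw [wordVal_cons, ← mul_assoc, ← map_mul, letter_mul_wordVal h]

theorem letter_mul_mem_wordSpan {i : K} (y : Ai i) {l : List (Σ i, Ai i)} (hl : IsAlternating E l)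
    (b : B) : emb i y * wordVal emb incl l b ∈ wordSpan E emb incl := by
  by_cases hi : HeadNe i l
  · rw [letter_mul_wordVal h]
    exact add_mem (incl_mul_mem_wordSpan h _ hl b)
      (wordVal_mem_wordSpan (isAlternating_cons.mpr ⟨(E i).exp_centre y, hi, hl⟩) b)
  · cases l with
    | nil => exact absurd (by simp [HeadNe]) hi
    | cons p l =>
      obtain ⟨j, x⟩ := p
      rw [headNe_cons, not_not] at hi
      dsimp only at hi
      subst hi
      obtain ⟨-, hh, hl⟩ := isAlternating_cons.mp hl
      rw [letter_mul_wordVal_cons h]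
      exact add_mem (incl_mul_mem_wordSpan h _ hl b)
        (wordVal_mem_wordSpan (isAlternating_cons.mpr ⟨(E i).exp_centre _, hh, hl⟩) b)

/-- The span contains `1` and is invariant under left multiplication by the generators: a product of
a letter and a word is re-centred into shorter and reduced words. -/
theorem mem_wordSpan_of_mem_adjoin {a : R}
    (ha : a ∈ Algebra.adjoin ℂ (Set.range incl ∪ ⋃ i, Set.range (emb i))) :
    a ∈ wordSpan E emb incl := by
  have key : ∀ w ∈ wordSpan E emb incl, a * w ∈ wordSpan E emb incl := by
    induction ha using Algebra.adjoin_induction with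
    | mem x hx =>
      intro w hw
      induction hw using Submodule.span_induction with
      | mem w hw =>
        obtain ⟨l, b, hl, rfl⟩ := hw
        rcases hx with ⟨c, rfl⟩ | hx
        · exact incl_mul_mem_wordSpan h c hl b
        · obtain ⟨i, y, rfl⟩ := Set.mem_iUnion.mp hx
          exact letter_mul_mem_wordSpan h y hl b
      | zero => rw [mul_zero]; exact zero_mem _
      | add u v _ _ hu hv => rw [mul_add]; exact add_mem hu hv
      | smul c u _ hu => rw [mul_smul_comm]; exact Submodule.smul_mem _ c hu
    | algebraMap r =>
      intro w hw
      rw [← Algebra.smul_def]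
      exact Submodule.smul_mem _ r hw
    | add x y _ _ hx hy => exact fun w hw => by rw [add_mul]; exact add_mem (hx w hw) (hy w hw)
    | mul x y _ _ hx hy => exact fun w hw => by rw [mul_assoc]; exact hx _ (hy w hw)
  have h1 : (1 : R) ∈ wordSpan E emb incl := by
    have := wordVal_mem_wordSpan (emb := emb) (incl := incl) (isAlternating_nil (E := E)) 1
    simpa [wordVal] using this
  simpa using key 1 h1

end Ring

theorem mem_wordSpan_of_mem_starAdjoin {A : Type*} [Ring A] [StarRing A] [Algebra ℂ A]
    [StarModule ℂ A] {emb : ∀ i, Ai i →⋆ₐ[ℂ] A} {incl : B →⋆ₐ[ℂ] A}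
    (h : ∀ i b, emb i ((E i).incl b) = incl b) {a : A}
    (ha : a ∈ StarAlgebra.adjoin ℂ (Set.range incl ∪ ⋃ i, Set.range (emb i))) :
    a ∈ wordSpan E (fun i => (emb i).toAlgHom) incl.toAlgHom := by
  refine mem_wordSpan_of_mem_adjoin h ?_
  have hs : star (Set.range incl ∪ ⋃ i, Set.range (emb i)) =
      Set.range incl ∪ ⋃ i, Set.range (emb i) := by
    have : ∀ s : Set A, (∀ x ∈ s, star x ∈ s) → star s = s := fun s hs =>
      Set.Subset.antisymm (fun x hx => by simpa using hs _ hx) fun x hx => hs x hx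
    refine this _ fun x hx => ?_
    rcases hx with ⟨c, rfl⟩ | hx
    · exact Or.inl ⟨star c, map_star incl c⟩
    · obtain ⟨i, y, rfl⟩ := Set.mem_iUnion.mp hx
      exact Or.inr (Set.mem_iUnion.mpr ⟨i, star y, map_star (emb i) y⟩)
  have ha' : a ∈ (StarAlgebra.adjoin ℂ (Set.range incl ∪ ⋃ i, Set.range (emb i))).toSubalgebra := ha
  rw [StarAlgebra.adjoin_toSubalgebra, hs, Set.union_self] at ha'
  exact ha'

end Words

/-! ### The scalar GNS space of an expectation -/

namespace CondExp

variable {B A : Type*} [CStarAlgebra B] [PartialOrder B] [StarOrderedRing B]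
  [FiniteDimensional ℂ B] [CStarAlgebra A] [PartialOrder A] [StarOrderedRing A] (φ : CondExp B A)

/-- The regular trace of `B`, composed with the conditional expectation. -/
def traceFunctional : A →ₚ[ℂ] ℂ :=
  PositiveLinearMap.mk₀ ((regularTrace B).comp φ.exp) fun x hx => by
    obtain ⟨y, rfl⟩ := CStarAlgebra.nonneg_iff_eq_star_mul_self.mp hx
    exact regularTrace_nonneg (φ.exp_nonneg y)

/-- The class of `1` in the GNS space. -/
def vacuum : φ.traceFunctional.GNS := (φ.traceFunctional.toPreGNS 1 : φ.traceFunctional.GNS)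

theorem gns_vacuum (a : A) : φ.traceFunctional.gnsStarAlgHom a φ.vacuum =
    (φ.traceFunctional.toPreGNS a : φ.traceFunctional.GNS) := by
  refine (φ.traceFunctional.gnsNonUnitalStarAlgHom_apply_coe).trans ?_
  rw [PositiveLinearMap.leftMulMapPreGNS_apply]
  simp

theorem inner_gns_vacuum (a b : A) :
    ⟪φ.traceFunctional.gnsStarAlgHom a φ.vacuum, φ.traceFunctional.gnsStarAlgHom b φ.vacuum⟫_ℂ =
      regularTrace B (φ.exp (star a * b)) := by
  rw [gns_vacuum, gns_vacuum]
  exact UniformSpace.Completion.inner_coe _ _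

theorem denseRange_gns_vacuum :
    DenseRange fun a => φ.traceFunctional.gnsStarAlgHom a φ.vacuum := by
  simp only [gns_vacuum]
  exact UniformSpace.Completion.denseRange_coe.comp φ.traceFunctional.toPreGNS.surjective.denseRange
    (UniformSpace.Completion.continuous_coe _)

theorem gns_vacuum_eq_zero_iff (a : A) :
    φ.traceFunctional.gnsStarAlgHom a φ.vacuum = 0 ↔ φ.exp (star a * a) = 0 := by
  rw [← inner_self_eq_zero (𝕜 := ℂ), inner_gns_vacuum]
  exact ⟨fun h => eq_zero_of_regularTrace_eq_zero (φ.exp_nonneg a) h, fun h => by rw [h, map_zero]⟩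

theorem gns_injective (h : φ.FaithfulGNS) : Function.Injective φ.traceFunctional.gnsStarAlgHom := by
  refine (injective_iff_map_eq_zero _).mpr fun a ha => h a fun x => ?_
  rw [← gns_vacuum_eq_zero_iff, map_mul, ha, zero_mul]
  rfl

end CondExp

/-- A finite frame for the centred elements, up to null elements. -/
theorem CondExp.exists_frame {B D : Type*} [CStarAlgebra B] [PartialOrder B] [StarOrderedRing B]
    [FiniteDimensional ℂ B] [CStarAlgebra D] [FiniteDimensional ℂ D] (E : CondExp B D) :
    ∃ n ≤ Module.finrank ℂ D, ∃ e : Fin n → D, (∀ g, E.exp (e g) = 0) ∧ ∀ x, E.exp x = 0 →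
      E.exp (star (x - ∑ g, e g * E.incl (E.exp (star (e g) * x))) *
        (x - ∑ g, e g * E.incl (E.exp (star (e g) * x)))) = 0 := by
  let := CStarAlgebra.spectralOrder D
  let := CStarAlgebra.spectralOrderedRing D
  let π := E.traceFunctional.gnsStarAlgHom
  let j : D →ₗ[ℂ] E.traceFunctional.GNS :=
    { toFun := fun x => π x E.vacuum
      map_add' := fun x y => by rw [map_add]; rfl
      map_smul' := fun c x => by rw [map_smul]; rfl }
  have hj : ∀ x y, ⟪j x, j y⟫_ℂ = regularTrace B (E.exp (star x * y)) := E.inner_gns_vacuum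
  have hj0 : ∀ x, j x = 0 ↔ E.exp (star x * x) = 0 := E.gns_vacuum_eq_zero_iff
  -- Faithfulness of the GNS representation does not make `j` injective, so identities hold modulo
  -- null elements; these are stable under right multiplication by `B`.
  have hjr : ∀ x b, j x = 0 → j (x * E.incl b) = 0 := fun x b hx => by
    rw [hj0] at hx ⊢
    rw [star_mul, ← map_star, mul_assoc, ← mul_assoc (star x), E.exp_incl_mul, E.exp_mul_incl, hx,
      zero_mul, mul_zero]
  let U := (LinearMap.ker E.exp).map j
  let u := stdOrthonormalBasis ℂ U
  choose e he hu using fun g => (u g).2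
  have hexp : ∀ y, E.exp y = 0 → ∀ b, ∑ g, ⟪j (e g), j y⟫_ℂ • j (e g * E.incl b) =
      j (y * E.incl b) := fun y hy b => by
    have h1 : j (∑ g, ⟪j (e g), j y⟫_ℂ • e g - y) = 0 := by
      have h2 := congrArg Subtype.val (u.sum_repr ⟨j y, ⟨y, hy, rfl⟩⟩)
      simp only [u.repr_apply_apply, Submodule.coe_sum, Submodule.coe_smul, Submodule.coe_inner,
        ← hu] at h2
      rw [map_sub, map_sum, sub_eq_zero]
      simpa using h2
    have h3 := hjr _ b h1
    rw [sub_mul, map_sub, sub_eq_zero, Finset.sum_mul, map_sum] at h3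
    simpa using h3
  obtain ⟨n, r, hr⟩ := exists_trace_basis (B := B)
  refine ⟨_, (Submodule.finrank_map_le j _).trans (Submodule.finrank_le _), e, he, fun x hx => ?_⟩
  rw [← hj0, map_sub, sub_eq_zero, map_sum]
  -- Expanding the `B`-valued coefficient in the basis `r` turns it into scalar coefficients of `x *
  -- star (r s)`. These reassemble to `x * star (r s) * r s`, and the sum over `s` is `x`.
  have h1 : ∀ g, j (e g * E.incl (E.exp (star (e g) * x))) =
      ∑ s, ⟪j (e g), j (x * E.incl (star (r s)))⟫_ℂ • j (e g * E.incl (r s)) := fun g => by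
    conv_lhs => rw [← hr (E.exp (star (e g) * x))]
    rw [map_sum, Finset.mul_sum, map_sum]
    refine Finset.sum_congr rfl fun s _ => ?_
    rw [map_smul, mul_smul_comm, map_smul, hj, ← mul_assoc, E.exp_mul_incl, regularTrace_mul_comm]
  have h2 : ∀ s, ∑ g, ⟪j (e g), j (x * E.incl (star (r s)))⟫_ℂ • j (e g * E.incl (r s)) =
      j (x * E.incl (star (r s) * r s)) := fun s => by
    rw [hexp _ (by rw [E.exp_mul_incl, hx, zero_mul]), mul_assoc, ← map_mul E.incl]
  simp only [h1]
  rw [Finset.sum_comm]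
  rw [Finset.sum_congr rfl fun s _ => h2 s, ← map_sum, ← Finset.mul_sum, ← map_sum, sum_star_trace_basis_mul hr, map_one, mul_one]

/-! ### First letter projections and frames for a free product -/

section FreeGNS

variable {B K : Type*} [CStarAlgebra B] [PartialOrder B] [StarOrderedRing B] {Ai : K → Type*}
  [∀ i, CStarAlgebra (Ai i)] {E : ∀ i, CondExp B (Ai i)} {A : Type*} [CStarAlgebra A]
  {φ : CondExp B A} {emb : ∀ i, Ai i →⋆ₐ[ℂ] A}

theorem IsReducedFreeProduct.exp_wordVal (hA : IsReducedFreeProduct E φ emb)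
    {l : List (Σ i, Ai i)} (hl : IsAlternating E l) (hne : l ≠ []) (b : B) :
    φ.exp (wordVal (fun i => (emb i).toAlgHom) φ.incl.toAlgHom l b) = 0 := by
  have h := hA.free l hne hl.1 hl.2
  refine (φ.exp_mul_incl _ b).trans ?_
  exact (congrArg (· * b) h).trans (zero_mul b)

theorem star_prod_letters (l : List (Σ i, Ai i)) :
    star (l.map fun p => emb p.1 p.2).prod =
      (((l.map fun p => (⟨p.1, star p.2⟩ : Σ i, Ai i)).reverse).map fun p => emb p.1 p.2).prod := by
  induction l with
  | nil => simp
  | cons p l ih => simp [ih, map_star]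

/-- The reversed adjoint of the first word, followed by the second, is again alternating and
nonempty, so freeness applies. This makes vectors beginning with `i` orthogonal to the others. -/
theorem IsReducedFreeProduct.exp_star_wordVal_mul (hA : IsReducedFreeProduct E φ emb) {i : K}
    {x : Ai i} {l l' : List (Σ i, Ai i)} (hl : IsAlternating E (⟨i, x⟩ :: l))
    (hl' : IsAlternating E l') (hi : HeadNe i l') (b b' : B) :
    φ.exp (star (wordVal (fun i => (emb i).toAlgHom) φ.incl.toAlgHom (⟨i, x⟩ :: l) b) *
      wordVal (fun i => (emb i).toAlgHom) φ.incl.toAlgHom l' b') = 0 := by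
  set s := ((((⟨i, x⟩ :: l : List (Σ i, Ai i)).map
    fun p => (⟨p.1, star p.2⟩ : Σ i, Ai i)).reverse)) with hs
  have e : star (wordVal (fun i => (emb i).toAlgHom) φ.incl.toAlgHom (⟨i, x⟩ :: l) b) *
      wordVal (fun i => (emb i).toAlgHom) φ.incl.toAlgHom l' b' =
      φ.incl (star b) * (((s ++ l').map fun p => emb p.1 p.2).prod * φ.incl b') := by
    rw [List.map_append, List.prod_append, hs, ← star_prod_letters, map_star]
    simp [wordVal, star_mul, mul_assoc]
  have halt : IsAlternating E (s ++ l') := by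
    refine ⟨List.isChain_append.mpr ⟨?_, hl'.1, ?_⟩, fun p hp => ?_⟩
    · rw [hs, List.isChain_reverse, List.isChain_map]
      exact hl.1.imp fun p q h => Ne.symm h
    · intro p hp q hq
      simp [hs] at hp
      subst hp
      exact hi q hq
    · rcases List.mem_append.mp hp with hp | hp
      · simp only [hs, List.mem_reverse, List.mem_map] at hp
        obtain ⟨q, hq, rfl⟩ := hp
        rw [CondExp.exp_star, hl.2 q hq, star_zero]
      · exact hl'.2 p hp
  have h0 := hA.free (s ++ l') (by simp [hs]) halt.1 halt.2
  rw [e, φ.exp_incl_mul, φ.exp_mul_incl, h0, zero_mul, mul_zero]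

variable [FiniteDimensional ℂ B] {H : Type*} [NormedAddCommGroup H] [InnerProductSpace ℂ H]
  [CompleteSpace H] (φ emb) (π : A →⋆ₐ[ℂ] (H →L[ℂ] H)) (Ω : H)

/-- The vector of a word. -/
def wordVec (l : List (Σ i, Ai i)) (b : B) : H :=
  π (wordVal (fun i => (emb i).toAlgHom) φ.incl.toAlgHom l b) Ω

variable (E) in
/-- The projection onto the words whose first letter has index `i`. -/
def firstProj (i : K) : H →L[ℂ] H :=
  (Submodule.span ℂ {v | ∃ (x : Ai i) (l : List (Σ i, Ai i)) (b : B), IsAlternating E (⟨i, x⟩ :: l) ∧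
    v = wordVec φ emb π Ω (⟨i, x⟩ :: l) b}).topologicalClosure.starProjection

variable {φ emb π Ω} (hA : IsReducedFreeProduct E φ emb)
  (hΩ : ∀ a b, ⟪π a Ω, π b Ω⟫_ℂ = regularTrace B (φ.exp (star a * b)))
  (hd : DenseRange fun a => π a Ω)

theorem headNe_or (i : K) (l : List (Σ i, Ai i)) : HeadNe i l ∨ ∃ x l', l = ⟨i, x⟩ :: l' := by
  cases l with
  | nil => exact Or.inl (by simp [HeadNe])
  | cons p l =>
    obtain ⟨j, x⟩ := p
    rw [headNe_cons]
    by_cases h : i = j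
    · subst h
      exact Or.inr ⟨x, l, rfl⟩
    · exact Or.inl h

theorem firstProj_cons {i : K} {x : Ai i} {l : List (Σ i, Ai i)}
    (hl : IsAlternating E (⟨i, x⟩ :: l)) (b : B) :
    firstProj E φ emb π Ω i (wordVec φ emb π Ω (⟨i, x⟩ :: l) b) =
      wordVec φ emb π Ω (⟨i, x⟩ :: l) b :=
  Submodule.starProjection_eq_self_iff.mpr
    (Submodule.le_topologicalClosure _ (Submodule.subset_span ⟨x, l, b, hl, rfl⟩))

include hA hΩ in
theorem firstProj_of_headNe {i : K} {l : List (Σ i, Ai i)} (hl : IsAlternating E l)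
    (hi : HeadNe i l) (b : B) : firstProj E φ emb π Ω i (wordVec φ emb π Ω l b) = 0 := by
  refine (Submodule.starProjection_apply_eq_zero_iff _).mpr ?_
  rw [Submodule.orthogonal_closure, Submodule.mem_orthogonal]
  intro v hv
  induction hv using Submodule.span_induction with
  | mem v hv =>
    obtain ⟨x, l', b', hl', rfl⟩ := hv
    rw [wordVec, wordVec, hΩ, hA.exp_star_wordVal_mul hl' hl hi, map_zero]
  | zero => exact inner_zero_left _
  | add u v _ _ hu hv => rw [inner_add_left, hu, hv, add_zero]
  | smul c u _ hu => rw [inner_smul_left, hu, mul_zero]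

include hA hd in
/-- Operators that agree on the words are equal. -/
theorem operator_ext {S T : H →L[ℂ] H} (h : ∀ l, IsAlternating E l → ∀ b,
    S (wordVec φ emb π Ω l b) = T (wordVec φ emb π Ω l b)) : S = T := by
  have h1 : ∀ a ∈ StarAlgebra.adjoin ℂ (Set.range φ.incl ∪ ⋃ i, Set.range (emb i)),
      S (π a Ω) = T (π a Ω) := fun a ha => by
    have := mem_wordSpan_of_mem_starAdjoin hA.emb_incl ha
    clear ha
    induction this using Submodule.span_induction with
    | mem w hw =>
      obtain ⟨l, b, hl, rfl⟩ := hw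
      exact h l hl b
    | zero => simp
    | add u v _ _ hu hv => simp only [map_add, add_apply, hu, hv]
    | smul c u _ hu => simp only [map_smul, smul_apply, hu]
  have hc : Continuous fun a => π a Ω :=
    (ContinuousLinearMap.apply ℂ H Ω).continuous.comp (map_continuous π)
  have h2 : ∀ a, S (π a Ω) = T (π a Ω) := by
    have hcl : IsClosed {a | S (π a Ω) = T (π a Ω)} :=
      isClosed_eq (S.continuous.comp hc) (T.continuous.comp hc)
    intro a
    have ha : a ∈ (StarAlgebra.adjoin ℂ
        (Set.range φ.incl ∪ ⋃ i, Set.range (emb i))).topologicalClosure := by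
      rw [hA.generates]; trivial
    exact closure_minimal h1 hcl ha
  exact DFunLike.coe_injective (hd.equalizer S.continuous T.continuous (funext h2))

include hA hΩ hd

theorem firstProj_orth {i j : K} (hij : i ≠ j) :
    firstProj E φ emb π Ω i * firstProj E φ emb π Ω j = 0 := by
  refine operator_ext hA hd fun l hl b => ?_
  rw [mul_apply_eq_comp]
  rcases headNe_or j l with h | ⟨x, l', rfl⟩
  · rw [firstProj_of_headNe hA hΩ hl h, map_zero]; rfl
  · rw [firstProj_cons hl, firstProj_of_headNe hA hΩ hl (headNe_cons.mpr hij)]; rfl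

theorem firstProj_comm (i : K) (c : B) :
    firstProj E φ emb π Ω i * π (φ.incl c) = π (φ.incl c) * firstProj E φ emb π Ω i := by
  refine operator_ext hA hd fun l hl b => ?_
  obtain ⟨l', b', hl', hll, e⟩ := incl_mul_wordVal (emb := fun i => (emb i).toAlgHom)
    (incl := φ.incl.toAlgHom) hA.emb_incl c hl b
  have e' : π (φ.incl c) (wordVec φ emb π Ω l b) = wordVec φ emb π Ω l' b' := by
    rw [wordVec, wordVec, ← e, map_mul]; rfl
  rw [mul_apply_eq_comp, mul_apply_eq_comp, e']
  rcases headNe_or i l with h | ⟨x, l2, rfl⟩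
  · rw [firstProj_of_headNe hA hΩ hl h, firstProj_of_headNe hA hΩ hl' ((headNe_of_map_eq hll).mpr h),
      map_zero]
  · rw [firstProj_cons hl, e']
    rcases headNe_or i l' with h | ⟨x', l3, rfl⟩
    · exact absurd rfl ((headNe_cons.mp ((headNe_of_map_eq hll).mp h)))
    · rw [firstProj_cons hl']

omit hΩ hd in
theorem emb_wordVec {i : K} (y : Ai i) (l : List (Σ i, Ai i)) (b : B) :
    π (emb i y) (wordVec φ emb π Ω l b) = π (φ.incl ((E i).exp y)) (wordVec φ emb π Ω l b) +
      wordVec φ emb π Ω (⟨i, (E i).centre y⟩ :: l) b := by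
  have h := letter_mul_wordVal (emb := fun i => (emb i).toAlgHom)
    (incl := φ.incl.toAlgHom) hA.emb_incl y l b
  have h2 := congrArg (fun a => π a Ω) h
  simp only [map_mul, map_add] at h2
  exact h2

/-- On a word not beginning with `i`, `y` acts as its expectation plus the creation of its centred
part, and the latter is killed by `1 - P i`. -/
theorem compress_emb (i : K) (y : Ai i) :
    (1 - firstProj E φ emb π Ω i) * π (emb i y) * (1 - firstProj E φ emb π Ω i) =
      π (φ.incl ((E i).exp y)) * (1 - firstProj E φ emb π Ω i) := by
  refine operator_ext hA hd fun l hl b => ?_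
  rw [mul_apply_eq_comp, mul_apply_eq_comp (π _)]
  rcases headNe_or i l with h | ⟨x, l2, rfl⟩
  · have h1 : (1 - firstProj E φ emb π Ω i) (wordVec φ emb π Ω l b) = wordVec φ emb π Ω l b := by
      rw [sub_apply, firstProj_of_headNe hA hΩ hl h, sub_zero]; rfl
    have h2 := firstProj_cons (π := π) (Ω := Ω) (φ := φ) (emb := emb)
      (isAlternating_cons.mpr ⟨(E i).exp_centre y, h, hl⟩) b
    have h3 := DFunLike.congr_fun (firstProj_comm hA hΩ hd i ((E i).exp y)) (wordVec φ emb π Ω l b)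
    rw [mul_apply_eq_comp, mul_apply_eq_comp, firstProj_of_headNe hA hΩ hl h, map_zero] at h3
    rw [mul_apply_eq_comp, h1, emb_wordVec hA, map_add, sub_apply, sub_apply, h2, h3]
    simp
  · have h1 : (1 - firstProj E φ emb π Ω i) (wordVec φ emb π Ω (⟨i, x⟩ :: l2) b) = 0 := by
      rw [sub_apply, firstProj_cons hl, one_apply_eq_self, sub_self]
    rw [h1, map_zero, map_zero]

theorem freeCompression : FreeCompression (π.comp φ.incl) (fun i => (π.comp (emb i)).range)
    (firstProj E φ emb π Ω) Ω where
  star_proj i := isStarProjection_starProjection.isSelfAdjoint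
  mul_self i := isStarProjection_starProjection.isIdempotentElem
  orth i j h := firstProj_orth hA hΩ hd h
  comm i b := firstProj_comm hA hΩ hd i b
  vacuum i b := by
    have := firstProj_of_headNe (i := i) hA hΩ isAlternating_nil (by simp [HeadNe]) b
    simpa [wordVec, wordVal] using this
  incl_mem i b := ⟨(E i).incl b, by simp [hA.emb_incl]⟩
  compress i y hy := by
    obtain ⟨a, rfl⟩ := hy
    exact ⟨(E i).exp a, compress_emb hA hΩ hd i a⟩

theorem exists_firstProj_frame (i : K) [FiniteDimensional ℂ (Ai i)] :
    ∃ n ≤ Module.finrank ℂ (Ai i), ∃ e : Fin n → Ai i, (∀ g, (E i).exp (e g) = 0) ∧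
      firstProj E φ emb π Ω i = ∑ g, π (emb i (e g)) * (1 - firstProj E φ emb π Ω i) *
        star (π (emb i (e g))) := by
  obtain ⟨n, hn, e, he, hx⟩ := (E i).exists_frame
  refine ⟨n, hn, e, he, ?_⟩
  set P := firstProj E φ emb π Ω i with hP
  have hF := freeCompression hA hΩ hd
  have hcomp := compress_emb hA hΩ hd i
  rw [← hP] at hcomp
  have key : ∀ x, (E i).exp x = 0 → (∑ g, π (emb i (e g)) * (1 - P) * star (π (emb i (e g)))) *
      π (emb i x) * (1 - P) = π (emb i x) * (1 - P) := fun x h0 => by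
    set z := x - ∑ g, e g * (E i).incl ((E i).exp (star (e g) * x)) with hz
    -- The element `z` need not vanish, but `(1 - P) z⋆z (1 - P)` is the expectation of `z⋆z` times
    -- `1 - P`, which is zero.
    have h1 : π (emb i z) * (1 - P) = 0 := by
      rw [← CStarRing.star_mul_self_eq_zero_iff, star_mul, hF.star_compl, ← map_star, ← map_star,
        mul_assoc, ← mul_assoc _ _ (1 - P), ← map_mul, ← map_mul, ← mul_assoc, hcomp, hx x h0]
      simp
    rw [hz, map_sub, map_sub, sub_mul, sub_eq_zero] at h1
    rw [h1, map_sum, map_sum, Finset.sum_mul, Finset.sum_mul, Finset.sum_mul]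
    refine Finset.sum_congr rfl fun g _ => ?_
    rw [map_mul, map_mul, hA.emb_incl, mul_assoc _ _ (1 - P), 
      mul_assoc (π _) (π (φ.incl _)), ← hcomp]
    simp only [map_mul, map_star, mul_assoc]
  refine operator_ext hA hd fun l hl b => ?_
  rcases headNe_or i l with h | ⟨x, l2, rfl⟩
  · rw [hP, firstProj_of_headNe hA hΩ hl h, sum_apply, eq_comm]
    refine Finset.sum_eq_zero fun g _ => ?_
    have h0 : (E i).exp (star (e g)) = 0 := by rw [CondExp.exp_star, he, star_zero]
    rw [← map_star, ← map_star, mul_apply_eq_comp, emb_wordVec hA, h0, mul_apply_eq_comp, sub_apply]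
    simp only [map_zero, zero_apply, zero_add]
    rw [firstProj_cons (isAlternating_cons.mpr ⟨(E i).exp_centre _, h, hl⟩), one_apply_eq_self,
      sub_self, map_zero]
  · obtain ⟨h0, hh, hl2⟩ := isAlternating_cons.mp hl
    have e1 : wordVec φ emb π Ω (⟨i, x⟩ :: l2) b =
        (π (emb i x) * (1 - P)) (wordVec φ emb π Ω l2 b) := by
      rw [mul_apply_eq_comp, sub_apply, hP, firstProj_of_headNe hA hΩ hl2 hh, sub_zero,
        wordVec, wordVal_cons, map_mul]
      rfl
    rw [hP, firstProj_cons hl, e1, ← hP]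
    have h := DFunLike.congr_fun (key x h0) (wordVec φ emb π Ω l2 b)
    rw [mul_assoc, mul_apply_eq_comp] at h
    exact h.symm

omit hA hd in
/-- The frame of the letters with index in `S`. -/
theorem exists_letterFrame (hA : IsReducedFreeProduct E φ emb) (hd : DenseRange fun a => π a Ω)
    [DecidableEq K] [∀ i, FiniteDimensional ℂ (Ai i)] {n : ℕ} {r : Fin n → B}
    (hr : ∀ c, ∑ s, regularTrace B (star (r s) * c) • r s = c) (S : Finset K) :
    ∃ F : LetterFrame (π.comp φ.incl) (fun i => (π.comp (emb i)).range)
      (firstProj E φ emb π Ω) Ω S,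
      Fintype.card F.G ≤ ∑ i ∈ S, Module.finrank ℂ (Ai i) ∧ Fintype.card F.R = n := by
  choose m hm e he hf using fun i => exists_firstProj_frame hA hΩ hd i
  let k : Fin S.card → K := fun k => S.equivFin.symm k
  have hk : ∀ i ∈ S, ∃ j, k j = i := fun i hi => ⟨S.equivFin ⟨i, hi⟩, by simp [k]⟩
  have hki : Function.Injective k := Subtype.val_injective.comp S.equivFin.symm.injective
  have hβ : ∀ b c, ⟪π (φ.incl b) Ω, π (φ.incl c) Ω⟫_ℂ = regularTrace B (star b * c) := fun b c => by
    rw [hΩ, ← map_star, ← map_mul, φ.exp_incl]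
  refine ⟨{
    G := Σ j : Fin S.card, Fin (m (k j))
    fintypeG := inferInstance
    idx := fun g => k g.1
    idx_mem := fun g => (S.equivFin.symm g.1).2
    e := fun g => π (emb (k g.1) (e _ g.2))
    e_mem := fun g => ⟨_, rfl⟩
    centred := fun g => by
      rw [compress_emb hA hΩ hd, he, map_zero, map_zero, zero_mul]
    frame := fun i hi => ?_
    R := Fin n
    fintypeR := inferInstance
    r := r
    frame_comm := fun b ξ => ?_
    frame_inner := fun X hX ξ η => ?_ }, ?_, Fintype.card_fin n⟩
  · obtain ⟨j, rfl⟩ := hk i hi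
    rw [Finset.sum_filter, Fintype.sum_sigma, Fintype.sum_eq_single j]
    · simpa using hf (k j)
    · intro j' hj'
      exact Finset.sum_eq_zero fun g _ => if_neg fun h => hj' (hki h)
  -- Both sides have the same coefficients, since `τ(rₜ⋆ b rₛ) = τ(rₛ rₜ⋆ b)` by the trace property.
  · simp only [StarAlgHom.comp_apply]
    have h1 : ∀ s, π (φ.incl b) (π (φ.incl (r s)) Ω) =
        ∑ t, regularTrace B (star (r t) * (b * r s)) • π (φ.incl (r t)) Ω := fun s => by
      rw [← mul_apply_eq_comp, ← map_mul, ← map_mul]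
      conv_lhs => rw [← hr (b * r s)]
      simp only [map_sum, map_smul, sum_apply, smul_apply]
    have h2 : ∀ s, star (π (φ.incl (r s))) (π (φ.incl b) ξ) =
        ∑ t, regularTrace B (r t * (star (r s) * b)) • star (π (φ.incl (r t))) ξ := fun s => by
      simp only [← map_star]
      rw [← mul_apply_eq_comp, ← map_mul, ← map_mul]
      conv_lhs => rw [← trace_basis_star hr (star (r s) * b)]
      simp only [map_sum, map_smul, sum_apply, smul_apply]
    simp only [h1, h2, TensorProduct.sum_tmul, TensorProduct.tmul_sum, TensorProduct.smul_tmul',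
      TensorProduct.tmul_smul]
    rw [Finset.sum_comm]
    refine Finset.sum_congr rfl fun s _ => Finset.sum_congr rfl fun t _ => ?_
    rw [← mul_assoc, regularTrace_mul_comm]
  · simp only [StarAlgHom.comp_apply] at hX ⊢
    simp only [sum_inner, inner_sum, TensorProduct.inner_tmul, hβ]
    have h1 : ∀ t, ∑ s, regularTrace B (star (r s) * r t) *
        ⟪star (π (φ.incl (r s))) ξ, X (star (π (φ.incl (r t))) η)⟫_ℂ =
        ⟪ξ, X (π (φ.incl (r t * star (r t))) η)⟫_ℂ := fun t => by
      have h2 : star (π (φ.incl (r t))) ξ = ∑ s, star (regularTrace B (star (r s) * r t)) •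
          star (π (φ.incl (r s))) ξ := by
        conv_lhs => rw [← hr (r t)]
        simp only [map_sum, map_smul, star_sum, star_smul, sum_apply, smul_apply]
      have h3 : ⟪ξ, X (π (φ.incl (r t * star (r t))) η)⟫_ℂ =
          ⟪star (π (φ.incl (r t))) ξ, X (star (π (φ.incl (r t))) η)⟫_ℂ := by
        rw [ContinuousLinearMap.star_eq_adjoint, ContinuousLinearMap.adjoint_inner_left,
          ← ContinuousLinearMap.star_eq_adjoint, ← mul_apply_eq_comp (π _), ← hX, map_mul, map_mul,
          map_star, map_star]
        rfl
      rw [h3]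
      conv_rhs => rw [h2]
      simp only [sum_inner, inner_smul_left]
      simp
    simp only [h1]
    rw [← inner_sum, ← map_sum, ← sum_apply, ← map_sum, ← map_sum, sum_trace_basis_mul_star hr,
      map_one, map_one, one_apply_eq_self]
  · rw [Fintype.card_sigma]
    simp only [Fintype.card_fin]
    calc ∑ j, m (k j) ≤ ∑ j, Module.finrank ℂ (Ai (k j)) := Finset.sum_le_sum fun j _ => hm _
      _ = ∑ i : S, Module.finrank ℂ (Ai i) :=
        S.equivFin.symm.sum_comp fun i : S => Module.finrank ℂ (Ai i)
      _ = _ := Finset.sum_coe_sort S fun i => Module.finrank ℂ (Ai i)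

end FreeGNS

/-! ### Associativity of the free product -/

section Iterated

variable {B I J : Type*} [CStarAlgebra B] [PartialOrder B] [StarOrderedRing B] {Dj : J → Type*}
  [∀ j, CStarAlgebra (Dj j)] {ψj : ∀ j, CondExp B (Dj j)} {D : Type*} [CStarAlgebra D]
  {ψ : CondExp B D} {emb : ∀ j, Dj j →⋆ₐ[ℂ] D} {A : Type*} [CStarAlgebra A] {φ : CondExp B A}
  {embI : I → D →⋆ₐ[ℂ] A}

/-- Grouping the neighbouring letters that belong to the same copy. -/
theorem IsReducedFreeProduct.exists_grouping (hD : IsReducedFreeProduct ψj ψ emb)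
    (p : Σ p : I × J, Dj p.2) (l : List (Σ p : I × J, Dj p.2))
    (hl : IsAlternating (fun p : I × J => ψj p.2) (p :: l)) :
    ∃ (x : Dj p.1.2) (m : List (Σ j, Dj j)) (L : List (Σ _ : I, D)),
      IsAlternating ψj (⟨p.1.2, x⟩ :: m) ∧
      IsAlternating (fun _ : I => ψ)
        (⟨p.1.1, ((⟨p.1.2, x⟩ :: m).map fun q => emb q.1 q.2).prod⟩ :: L) ∧
      ((p :: l).map fun q => (embI q.1.1).comp (emb q.1.2) q.2).prod =
        (((⟨p.1.1, ((⟨p.1.2, x⟩ :: m).map fun q => emb q.1 q.2).prod⟩ :: L : List (Σ _ : I, D))).map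
          fun q => embI q.1 q.2).prod := by
  have hcons : ∀ {j : J} {x : Dj j} {m : List (Σ j, Dj j)}, IsAlternating ψj (⟨j, x⟩ :: m) →
      ψ.exp (((⟨j, x⟩ :: m).map fun q => emb q.1 q.2).prod) = 0 := fun h =>
    hD.free _ (by simp) h.1 h.2
  induction l generalizing p with
  | nil =>
    obtain ⟨⟨i, j⟩, x⟩ := p
    have h1 : IsAlternating ψj [⟨j, x⟩] :=
      isAlternating_cons.mpr ⟨hl.2 ⟨(i, j), x⟩ (by simp), by simp [HeadNe], isAlternating_nil⟩
    exact ⟨x, [], [], h1, isAlternating_cons.mpr ⟨hcons h1, by simp [HeadNe], isAlternating_nil⟩,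
      by simp⟩
  | cons p' l ih =>
    obtain ⟨⟨i, j⟩, x⟩ := p
    obtain ⟨hx, hne, hl'⟩ := isAlternating_cons.mp hl
    rw [headNe_cons] at hne
    obtain ⟨x', m, L, hm, hL, e⟩ := ih p' hl'
    obtain ⟨⟨i', j'⟩, y'⟩ := p'
    dsimp only at hm hL e hx hne ⊢
    by_cases hi : i = i'
    · subst hi
      have hj : j ≠ j' := fun h => hne (by rw [h])
      have h1 : IsAlternating ψj (⟨j, x⟩ :: ⟨j', x'⟩ :: m) :=
        isAlternating_cons.mpr ⟨hx, headNe_cons.mpr hj, hm⟩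
      refine ⟨x, ⟨j', x'⟩ :: m, L, h1, isAlternating_cons.mpr ⟨hcons h1,
        (isAlternating_cons.mp hL).2⟩, ?_⟩
      rw [List.map_cons, List.prod_cons, e]
      simp [mul_assoc]
    · have h1 : IsAlternating ψj [⟨j, x⟩] :=
        isAlternating_cons.mpr ⟨hx, by simp [HeadNe], isAlternating_nil⟩
      refine ⟨x, [], _, h1, isAlternating_cons.mpr ⟨hcons h1, headNe_cons.mpr hi, hL⟩, ?_⟩
      rw [List.map_cons, List.prod_cons, e]
      simp

/-- A free product of copies of a free product is a free product. -/
theorem IsReducedFreeProduct.iterate (hD : IsReducedFreeProduct ψj ψ emb)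
    (hA : IsReducedFreeProduct (fun _ : I => ψ) φ embI) :
    IsReducedFreeProduct (fun p : I × J => ψj p.2) φ
      (fun p : I × J => (embI p.1).comp (emb p.2)) where
  emb_incl p b := by rw [StarAlgHom.comp_apply, hD.emb_incl, hA.emb_incl]
  exp_emb p a := by rw [StarAlgHom.comp_apply, hA.exp_emb, hD.exp_emb]
  generates := by
    set C := (StarAlgebra.adjoin ℂ (Set.range φ.incl ∪
      ⋃ p : I × J, Set.range ((embI p.1).comp (emb p.2)))).topologicalClosure with hC
    have hCc : IsClosed (C : Set A) := StarSubalgebra.isClosed_topologicalClosure _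
    have hsub : (Set.range φ.incl ∪ ⋃ p : I × J, Set.range ((embI p.1).comp (emb p.2))) ⊆
        (C : Set A) := (StarAlgebra.subset_adjoin ℂ _).trans
      (StarSubalgebra.le_topologicalClosure _)
    rw [eq_top_iff, ← hA.generates]
    refine StarSubalgebra.topologicalClosure_minimal (StarAlgebra.adjoin_le ?_) hCc
    refine Set.union_subset (Set.subset_union_left.trans hsub) (Set.iUnion_subset fun i => ?_)
    rintro _ ⟨d, rfl⟩
    have hd : d ∈ (StarAlgebra.adjoin ℂ
        (Set.range ψ.incl ∪ ⋃ j, Set.range (emb j))).topologicalClosure := by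
      rw [hD.generates]; trivial
    have hle : StarAlgebra.adjoin ℂ (Set.range ψ.incl ∪ ⋃ j, Set.range (emb j)) ≤
        C.comap (embI i) := by
      refine StarAlgebra.adjoin_le (Set.union_subset ?_ (Set.iUnion_subset fun j => ?_))
      · rintro _ ⟨b, rfl⟩
        exact hsub (Or.inl ⟨b, (hA.emb_incl i b).symm⟩)
      · rintro _ ⟨x, rfl⟩
        exact hsub (Or.inr (Set.mem_iUnion.mpr ⟨(i, j), x, rfl⟩))
    have := StarSubalgebra.topologicalClosure_minimal hle
      (hCc.preimage (map_continuous (embI i)))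
    exact this hd
  free l hne hc h0 := by
    cases l with
    | nil => exact absurd rfl hne
    | cons p l =>
      obtain ⟨x, m, L, -, hL, e⟩ := hD.exists_grouping (embI := embI) p l ⟨hc, h0⟩
      exact (congrArg φ.exp e).trans (hA.free _ (by simp) hL.1 hL.2)
  faithful := hA.faithful

end Iterated

/-! ### Existence of free permutations -/

section Permutation

variable {B : Type*} [CStarAlgebra B] [PartialOrder B] [StarOrderedRing B] [FiniteDimensional ℂ B]

/-- Two homomorphisms that induce the same expectation, the first one with dense range in an
algebra with faithful GNS representation. -/
theorem norm_le_of_exp_eq {G A A' : Type*} [Ring G] [StarRing G] [Algebra ℂ G] [CStarAlgebra A]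
    [CStarAlgebra A'] {φ : CondExp B A} {φ' : CondExp B A'} (hφ : φ.FaithfulGNS) (p : G →⋆ₐ[ℂ] A)
    (q : G →⋆ₐ[ℂ] A') (hp : DenseRange p) (h : ∀ g, φ.exp (p g) = φ'.exp (q g)) (g : G) :
    ‖p g‖ ≤ ‖q g‖ := by
  let := CStarAlgebra.spectralOrder A
  let := CStarAlgebra.spectralOrderedRing A
  let := CStarAlgebra.spectralOrder A'
  let := CStarAlgebra.spectralOrderedRing A'
  set π := φ.traceFunctional.gnsStarAlgHom with hπ
  set π' := φ'.traceFunctional.gnsStarAlgHom with hπ'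
  have h1 : ∀ g, ‖π (p g) φ.vacuum‖ = ‖π' (q g) φ'.vacuum‖ := fun g => by
    rw [norm_eq_sqrt_re_inner (𝕜 := ℂ), norm_eq_sqrt_re_inner (𝕜 := ℂ), hπ, hπ',
      φ.inner_gns_vacuum, φ'.inner_gns_vacuum, ← map_star, ← map_mul, ← map_star, ← map_mul, h]
  have hd : DenseRange fun g => π (p g) φ.vacuum :=
    φ.denseRange_gns_vacuum.comp hp
      ((ContinuousLinearMap.apply ℂ _ φ.vacuum).continuous.comp (map_continuous π))
  -- Faithfulness makes `π` isometric, so the norm can be tested on the dense vectors, whose norms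
  -- depend only on the common expectation.
  rw [← NonUnitalStarAlgHom.norm_map π (φ.gns_injective hφ)]
  refine ContinuousLinearMap.opNorm_le_bound _ (norm_nonneg _) fun ξ => ?_
  induction ξ using hd.induction_on with
  | hp => exact isClosed_le (π (p g)).continuous.norm (continuous_const.mul continuous_norm)
  | ih x =>
    rw [← mul_apply_eq_comp, ← map_mul, ← map_mul, h1, h1, map_mul, map_mul, mul_apply_eq_comp]
    exact ((π' (q g)).le_opNorm _).trans (mul_le_mul_of_nonneg_right
      (NonUnitalStarAlgHom.norm_apply_le π' (q g)) (norm_nonneg _))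

variable {I D A : Type*} [CStarAlgebra D] {ψ : CondExp B D} [CStarAlgebra A] {φ : CondExp B A}
  {emb : I → D →⋆ₐ[ℂ] A}

theorem IsReducedFreeProduct.exists_isFreePermutation
    (hA : IsReducedFreeProduct (fun _ : I => ψ) φ emb) (σ : Equiv.Perm I) :
    ∃ α : A ≃⋆ₐ[ℂ] A, IsFreePermutation φ emb σ α := by
  -- These pairs generate a dense part of the graph of the required automorphism. Relabelling
  -- preserves alternation, so both coordinates have the same expectation.
  let emb₂ : I → D →⋆ₐ[ℂ] A × A := fun i => (emb i).prod (emb (σ i))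
  let incl₂ : B →⋆ₐ[ℂ] A × A := φ.incl.prod φ.incl
  set 𝒢 := StarAlgebra.adjoin ℂ (Set.range incl₂ ∪ ⋃ i, Set.range (emb₂ i)) with h𝒢
  have hincl : ∀ b, incl₂ b ∈ 𝒢 := fun b => StarAlgebra.subset_adjoin ℂ _ (Or.inl ⟨b, rfl⟩)
  have hemb : ∀ i d, emb₂ i d ∈ 𝒢 := fun i d =>
    StarAlgebra.subset_adjoin ℂ _ (Or.inr (Set.mem_iUnion.mpr ⟨i, d, rfl⟩))
  have hexp : ∀ g ∈ 𝒢, φ.exp g.1 = φ.exp g.2 := fun g hg => by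
    have hw := mem_wordSpan_of_mem_starAdjoin (E := fun _ : I => ψ) (emb := emb₂) (incl := incl₂)
      (fun i b => Prod.ext (hA.emb_incl i b) (hA.emb_incl (σ i) b)) hg
    clear hg
    induction hw using Submodule.span_induction with
    | mem w hw =>
      obtain ⟨l, b, hl, rfl⟩ := hw
      have e1 : (wordVal (fun i => (emb₂ i).toAlgHom) incl₂.toAlgHom l b).1 =
          wordVal (fun i => (emb i).toAlgHom) φ.incl.toAlgHom l b := by
        induction l with
        | nil => simp [wordVal, incl₂]
        | cons p l ih => rw [wordVal_cons, wordVal_cons, ← ih (isAlternating_cons.mp hl).2.2]; rfl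
      have e2 : (wordVal (fun i => (emb₂ i).toAlgHom) incl₂.toAlgHom l b).2 =
          wordVal (fun i => (emb i).toAlgHom) φ.incl.toAlgHom
            (l.map fun p => (⟨σ p.1, p.2⟩ : Σ _ : I, D)) b := by
        clear e1
        induction l with
        | nil => simp [wordVal, incl₂]
        | cons p l ih =>
          rw [List.map_cons, wordVal_cons, wordVal_cons, ← ih (isAlternating_cons.mp hl).2.2]; rfl
      rw [e1, e2]
      rcases eq_or_ne l [] with rfl | hne
      · rfl
      · rw [hA.exp_wordVal hl hne, hA.exp_wordVal _ (by simpa using hne)]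
        refine ⟨?_, ?_⟩
        · rw [List.isChain_map]
          exact hl.1.imp fun p q h h' => h (σ.injective h')
        · intro p hp
          obtain ⟨q, hq, rfl⟩ := List.mem_map.mp hp
          exact hl.2 q hq
    | zero => rfl
    | add u v _ _ hu hv => rw [Prod.fst_add, Prod.snd_add, map_add, map_add, hu, hv]
    | smul c u _ hu => rw [Prod.smul_fst, Prod.smul_snd, map_smul, map_smul, hu]
  have hdense : ∀ f : A × A →⋆ₐ[ℂ] A, (∀ b, φ.incl b ∈ 𝒢.map f) → (∀ i d, emb i d ∈ 𝒢.map f) →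
      DenseRange (f.comp 𝒢.subtype) := fun f h1 h2 => by
    have hle : StarAlgebra.adjoin ℂ (Set.range φ.incl ∪ ⋃ i, Set.range (emb i)) ≤ 𝒢.map f := by
      refine StarAlgebra.adjoin_le (Set.union_subset ?_ (Set.iUnion_subset fun i => ?_))
      · rintro _ ⟨b, rfl⟩
        exact h1 b
      · rintro _ ⟨d, rfl⟩
        exact h2 i d
    intro a
    have ha : a ∈ (StarAlgebra.adjoin ℂ
        (Set.range φ.incl ∪ ⋃ i, Set.range (emb i))).topologicalClosure := by
      rw [hA.generates]; trivial
    refine closure_mono ?_ ha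
    refine fun x hx => ?_
    obtain ⟨g, hg, rfl⟩ := hle hx
    exact ⟨⟨g, hg⟩, rfl⟩
  have hd1 := hdense (StarAlgHom.fst ℂ A A) (fun b => ⟨_, hincl b, rfl⟩) fun i d => ⟨_, hemb i d, rfl⟩
  have hd2 := hdense (StarAlgHom.snd ℂ A A) (fun b => ⟨_, hincl b, rfl⟩) fun i d =>
    ⟨_, hemb (σ.symm i) d, congrArg (fun i => emb i d) (σ.apply_symm_apply i)⟩
  have hnorm : ∀ g ∈ 𝒢, ‖g.1‖ = ‖g.2‖ := fun g hg => le_antisymm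
    (norm_le_of_exp_eq (φ' := φ) hA.faithful _
      ((StarAlgHom.snd ℂ A A).comp 𝒢.subtype) hd1 (fun g => hexp g g.2) (⟨g, hg⟩ : 𝒢))
    (norm_le_of_exp_eq (φ' := φ) hA.faithful _
      ((StarAlgHom.fst ℂ A A).comp 𝒢.subtype) hd2 (fun g => (hexp g g.2).symm) (⟨g, hg⟩ : 𝒢))
  -- On the closure both coordinate projections are isometric with closed dense range, hence
  -- bijective onto `A`; the automorphism is the second after the inverse of the first.
  set 𝒞 := 𝒢.topologicalClosure
  have hle : 𝒢 ≤ 𝒞 := StarSubalgebra.le_topologicalClosure _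
  have hcl : IsClosed (𝒞 : Set (A × A)) := StarSubalgebra.isClosed_topologicalClosure _
  have hnorm' : ∀ g ∈ 𝒞, ‖g.1‖ = ‖g.2‖ := fun g hg =>
    closure_minimal hnorm (isClosed_eq continuous_fst.norm continuous_snd.norm) hg
  have hbij : ∀ f : A × A →⋆ₐ[ℂ] A, (∀ g ∈ 𝒞, ‖f g‖ = ‖g‖) → DenseRange (f.comp 𝒢.subtype) →
      Function.Bijective (f.comp 𝒞.subtype) := fun f hf hd => by
    have : CompleteSpace 𝒞 := hcl.completeSpace_coe
    have hi : Isometry (f.comp 𝒞.subtype) :=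
      AddMonoidHomClass.isometry_of_norm _ fun g => hf g g.2
    refine ⟨hi.injective, fun a => ?_⟩
    have hsub : Set.range (f.comp 𝒢.subtype) ⊆ Set.range (f.comp 𝒞.subtype) := by
      rintro _ ⟨g, rfl⟩
      exact ⟨⟨g, hle g.2⟩, rfl⟩
    exact closure_minimal hsub hi.isClosedEmbedding.isClosed_range (hd a)
  let p := StarAlgEquiv.ofBijective _ (hbij (StarAlgHom.fst ℂ A A)
    (fun g hg => by rw [Prod.norm_def, ← hnorm' g hg, max_self]; rfl) hd1)
  let q := StarAlgEquiv.ofBijective _ (hbij (StarAlgHom.snd ℂ A A)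
    (fun g hg => by rw [Prod.norm_def, hnorm' g hg, max_self]; rfl) hd2)
  have hpq : ∀ g ∈ 𝒢, p.symm.trans q g.1 = g.2 := fun g hg => by
    rw [StarAlgEquiv.trans_apply, show p.symm g.1 = (⟨g, hle hg⟩ : 𝒞) from
      p.injective (p.apply_symm_apply _)]
    rfl
  exact ⟨p.symm.trans q, (fun i d => hpq _ (hemb i d)), fun b => hpq _ (hincl b)⟩

end Permutation

/-! ### Growth rates of ranks -/

section Growth

theorem one_le_cstarRank (C : Type*) [CStarAlgebra C] [Nontrivial C] [FiniteDimensional ℂ C] :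
    1 ≤ cstarRank C := by
  have h : Module.finrank ℂ (⊥ : StarSubalgebra ℂ C) = 1 := by
    have : Module.finrank ℂ (⊥ : Subalgebra ℂ C) = 1 := Subalgebra.finrank_bot
    rw [← this]
    exact LinearEquiv.finrank_eq (LinearEquiv.ofEq
      (Subalgebra.toSubmodule (⊥ : StarSubalgebra ℂ C).toSubalgebra) (Subalgebra.toSubmodule ⊥)
      (by rw [StarSubalgebra.bot_toSubalgebra]))
  refine le_trans ?_ (le_iSup₂ (f := fun (S : StarSubalgebra ℂ C)
    (_ : ∀ a ∈ S, ∀ b ∈ S, a * b = b * a) => (Module.finrank ℂ S : ℕ∞)) ⊥ fun a ha b _ => ?_)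
  · rw [h]; rfl
  · obtain ⟨c, rfl⟩ := StarSubalgebra.mem_bot.mp ha
    exact Algebra.commutes c b

variable {A : Type*} [CStarAlgebra A] [PartialOrder A] [StarOrderedRing A]
  {H : Type*} [NormedAddCommGroup H] [InnerProductSpace ℂ H] [CompleteSpace H]
  (π : A →⋆ₐ[ℂ] (H →L[ℂ] H)) (α : A ≃⋆ₐ[ℂ] A)

theorem one_le_rcp (ω : Set A) (δ : ℝ) : 1 ≤ rcp π ω δ :=
  le_iInf fun F => @one_le_cstarRank F.C F.cstar F.nontriv F.finDim

theorem htGrowth_nonneg (ω : Set A) (δ : ℝ) : 0 ≤ htGrowth π α ω δ := by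
  refine le_trans (b := Filter.limsup (fun _ : ℕ => (0 : EReal)) Filter.atTop)
    (by rw [Filter.limsup_const]) (Filter.limsup_le_limsup (Filter.Eventually.of_forall fun n => ?_))
  refine EReal.div_nonneg (ENNReal.zero_le_log_iff.mpr ?_) (Nat.cast_nonneg' n)
  exact_mod_cast one_le_rcp π _ δ

theorem htRep_nonneg : 0 ≤ htRep π α :=
  (htGrowth_nonneg π α ((∅ : Finset A) : Set A) 1).trans
    (le_iSup_of_le ∅ (le_iSup₂_of_le (1 : ℝ) one_pos le_rfl))

theorem ht_nonneg : 0 ≤ ht α :=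
  le_iInf fun _ => le_iInf fun _ => le_iInf fun _ => le_iInf fun _ => le_iInf fun π =>
    le_iInf fun _ => htRep_nonneg π α

theorem tendsto_log_mul_pow_div {c : ℝ} (hc : 0 < c) (d : ℕ) :
    Filter.Tendsto (fun n : ℕ => Real.log (c * (n : ℝ) ^ d) / n) Filter.atTop (nhds 0) := by
  have h1 : Filter.Tendsto (fun n : ℕ => Real.log c / (n : ℝ)) Filter.atTop (nhds 0) :=
    tendsto_const_div_atTop_nhds_zero_nat _
  have h2 : Filter.Tendsto (fun n : ℕ => Real.log n / (n : ℝ)) Filter.atTop (nhds 0) :=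
    Real.isLittleO_log_id_atTop.tendsto_div_nhds_zero.comp tendsto_natCast_atTop_atTop
  have h3 := h1.add (h2.const_mul (d : ℝ))
  rw [mul_zero, add_zero] at h3
  refine h3.congr' ?_
  filter_upwards [Filter.eventually_ge_atTop 1] with n hn
  have : (n : ℝ) ≠ 0 := by positivity
  rw [Real.log_mul hc.ne' (pow_ne_zero _ this), Real.log_pow]
  ring

/-- A polynomial bound for the ranks. -/
theorem htGrowth_nonpos {ω : Set A} {δ : ℝ} {c d : ℕ} (hc : 0 < c)
    (h : ∀ n : ℕ, 1 ≤ n → rcp π (⋃ k ∈ Finset.range n, (⇑α)^[k] '' ω) δ ≤ (c * n ^ d : ℕ)) :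
    htGrowth π α ω δ ≤ 0 := by
  have h1 : Filter.Tendsto (fun n : ℕ => ((Real.log (c * (n : ℝ) ^ d) / n : ℝ) : EReal))
      Filter.atTop (nhds 0) := by
    have := tendsto_log_mul_pow_div (c := c) (by exact_mod_cast hc) d
    exact EReal.tendsto_coe.mpr this
  rw [← h1.limsup_eq]
  refine Filter.limsup_le_limsup ?_
  filter_upwards [Filter.eventually_ge_atTop 1] with n hn
  rw [EReal.coe_div]
  refine EReal.div_le_div_right_of_nonneg (Nat.cast_nonneg' n) ?_
  have hpos : (0 : ℝ) < c * (n : ℝ) ^ d := by positivity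
  rw [← ENNReal.log_ofReal_of_pos hpos]
  refine ENNReal.log_le_log ?_
  have h2 : ENNReal.ofReal (c * (n : ℝ) ^ d) = (((c * n ^ d : ℕ) : ℕ∞) : ℝ≥0∞) := by
    have : (c * (n : ℝ) ^ d) = ((c * n ^ d : ℕ) : ℝ) := by push_cast; rfl
    rw [this, ENNReal.ofReal_natCast]
    rfl
  rw [h2]
  exact_mod_cast h n hn

end Growth

/-! ### Passing from letters to arbitrary elements -/

section AlmostIntertwined

variable {B H K : Type*} [DecidableEq K] [CStarAlgebra B] [NormedAddCommGroup H]
  [InnerProductSpace ℂ H] [CompleteSpace H]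

/-- The maps `splitMean` of the frames over `S` intertwine `x` up to `c / √N`. -/
def AlmostIntertwined (β : B →⋆ₐ[ℂ] (H →L[ℂ] H)) (M : K → StarSubalgebra ℂ (H →L[ℂ] H))
    (P : K → H →L[ℂ] H) (Ω : H) (S : Finset K) (c : ℝ) (x : H →L[ℂ] H) : Prop :=
  ∀ (F : LetterFrame β M P Ω S) (N : ℕ), 1 ≤ N → ∀ ξ,
    ‖leftLeg x (F.splitMean N ξ) - F.splitMean N (x ξ)‖ ≤ c * (1 / √N) * ‖ξ‖

variable {β : B →⋆ₐ[ℂ] (H →L[ℂ] H)} {M : K → StarSubalgebra ℂ (H →L[ℂ] H)}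
  {P : K → H →L[ℂ] H} {Ω : H} {S : Finset K} {c c' : ℝ} {x y : H →L[ℂ] H}

namespace AlmostIntertwined

theorem mono (hx : AlmostIntertwined β M P Ω S c x) (h : c ≤ c') :
    AlmostIntertwined β M P Ω S c' x := fun F N hN ξ => (hx F N hN ξ).trans (by gcongr)

theorem zero : AlmostIntertwined β M P Ω S 0 (0 : H →L[ℂ] H) := fun F N hN ξ => by simp

theorem add (hx : AlmostIntertwined β M P Ω S c x) (hy : AlmostIntertwined β M P Ω S c' y) :
    AlmostIntertwined β M P Ω S (c + c') (x + y) := fun F N hN ξ => by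
  have e : leftLeg (x + y) (F.splitMean N ξ) - F.splitMean N ((x + y) ξ) =
      (leftLeg x (F.splitMean N ξ) - F.splitMean N (x ξ)) +
      (leftLeg y (F.splitMean N ξ) - F.splitMean N (y ξ)) := by
    rw [map_add, LinearMap.add_apply, add_apply, map_add]
    abel
  rw [e]
  refine (norm_add_le _ _).trans ((add_le_add (hx F N hN ξ) (hy F N hN ξ)).trans (le_of_eq ?_))
  ring

theorem smul (t : ℂ) (hx : AlmostIntertwined β M P Ω S c x) :
    AlmostIntertwined β M P Ω S (‖t‖ * c) (t • x) := fun F N hN ξ => by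
  have e : leftLeg (t • x) (F.splitMean N ξ) - F.splitMean N ((t • x) ξ) =
      t • (leftLeg x (F.splitMean N ξ) - F.splitMean N (x ξ)) := by
    rw [map_smul, LinearMap.smul_apply, smul_apply, map_smul, smul_sub]
  rw [e, norm_smul, mul_assoc, mul_assoc, ← mul_assoc c]
  exact mul_le_mul_of_nonneg_left (hx F N hN ξ) (norm_nonneg t)

variable (hP : FreeCompression β M P Ω)
include hP

theorem incl (b : B) : AlmostIntertwined β M P Ω S 0 (β b) := fun F N hN ξ => by
  rw [F.leftLeg_incl_splitMean hP]
  simp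

theorem letter {i : K} (hi : i ∈ S) (hx : x ∈ M i) (h0 : (1 - P i) * x * (1 - P i) = 0) :
    AlmostIntertwined β M P Ω S (5 * ‖x‖) x := fun F N hN ξ =>
  (F.norm_leftLeg_splitMean_sub_le hP hN hi hx h0 ξ).trans (le_of_eq (by ring))

/-- The defect satisfies a Leibniz rule. -/
theorem mul (hc : 0 ≤ c) (hx : AlmostIntertwined β M P Ω S c x)
    (hy : AlmostIntertwined β M P Ω S c' y) :
    AlmostIntertwined β M P Ω S (‖x‖ * c' + c * ‖y‖) (x * y) := fun F N hN ξ => by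
  have e : leftLeg (x * y) (F.splitMean N ξ) - F.splitMean N ((x * y) ξ) =
      leftLeg x (leftLeg y (F.splitMean N ξ) - F.splitMean N (y ξ)) +
      (leftLeg x (F.splitMean N (y ξ)) - F.splitMean N (x (y ξ))) := by
    rw [map_mul, Module.End.mul_apply, mul_apply_eq_comp, map_sub]
    abel
  rw [e]
  calc _ ≤ ‖x‖ * (c' * (1 / √N) * ‖ξ‖) + c * (1 / √N) * (‖y‖ * ‖ξ‖) := by
        refine (norm_add_le _ _).trans (add_le_add ((norm_leftLeg_le _ _).trans ?_) ?_)
        · exact mul_le_mul_of_nonneg_left (hy F N hN ξ) (norm_nonneg x)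
        · exact (hx F N hN _).trans (mul_le_mul_of_nonneg_left (y.le_opNorm ξ) (by positivity))
    _ = _ := by ring

end AlmostIntertwined

/-- Approximation through the map `splitMean`. -/
theorem rcp_le_of_letterFrame {A : Type*} [CStarAlgebra A] [PartialOrder A] [StarOrderedRing A]
    (π : A →⋆ₐ[ℂ] (H →L[ℂ] H)) (hP : FreeCompression β M P Ω) (F : LetterFrame β M P Ω S)
    {N : ℕ} (hN : 1 ≤ N) {ω : Set A} {δ c : ℝ} (hδ : 0 < δ) (hc : c * (1 / √N) ≤ δ / 4)
    (h : ∀ a ∈ ω, ∃ a', ‖a - a'‖ ≤ δ / 4 ∧ AlmostIntertwined β M P Ω S c (π a')) :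
    rcp π ω δ ≤
      (((N + 1) * (Fintype.card F.R * (Fintype.card F.G + 1) ^ (N + 1)) + 1) ^ 2 : ℕ) := by
  obtain ⟨ι, _, f, W, hm, hfW⟩ := F.hasLegRank_combine (headWeight N) (tailWeight N) (N + 1)
  set V := F.splitMean N
  have hV : ∀ ξ, ‖V ξ‖ = ‖ξ‖ := F.norm_splitMean hP hN
  let V' : H →ₗᵢ[ℂ] H ⊗[ℂ] H := ⟨V, hV⟩
  have hVi : ∀ ξ η, ⟪V ξ, V η⟫_ℂ = ⟪ξ, η⟫_ℂ := V'.inner_map_map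
  -- Replacing `a` by `a'` costs `δ/4` on each side of `V`, and the defect of `a'` another `δ/4`.
  refine (rcp_le_of_tensor π (ε := 3 / 4 * δ) (by positivity) (by linarith) V
    (fun ξ => (hV ξ).le) f W hfW fun a ha ξ η => ?_).trans ?_
  · obtain ⟨a', h1, h2⟩ := h a ha
    have hπ : ‖π (a - a')‖ ≤ δ / 4 := (NonUnitalStarAlgHom.norm_apply_le π _).trans h1
    have e : leftLeg (π a) (V η) - V (π a η) = leftLeg (π (a - a')) (V η) +
        (leftLeg (π a') (V η) - V (π a' η)) - V (π (a - a') η) := by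
      simp only [map_sub, LinearMap.sub_apply, sub_apply]
      abel
    have hb : ‖leftLeg (π a) (V η) - V (π a η)‖ ≤ 3 / 4 * δ * ‖η‖ := by
      rw [e]
      calc _ ≤ ‖leftLeg (π (a - a')) (V η)‖ + ‖leftLeg (π a') (V η) - V (π a' η)‖ +
            ‖V (π (a - a') η)‖ := (norm_sub_le _ _).trans (by gcongr; exact norm_add_le _ _)
        _ ≤ δ / 4 * ‖η‖ + δ / 4 * ‖η‖ + δ / 4 * ‖η‖ := by
          gcongr
          · exact (norm_leftLeg_le _ _).trans (by rw [hV]; gcongr)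
          · exact (h2 F N hN η).trans (by gcongr)
          · rw [hV]
            exact ((π (a - a')).le_opNorm η).trans (by gcongr)
        _ = _ := by ring
    rw [← leftLeg_apply, ← hVi]
    refine (congrArg norm (inner_sub_right (𝕜 := ℂ) (V ξ) (leftLeg (π a) (V η)) (V (π a η)))).symm.le.trans
      ((norm_inner_le_norm _ _).trans ?_)
    rw [hV]
    calc _ ≤ ‖ξ‖ * (3 / 4 * δ * ‖η‖) := by gcongr
      _ = _ := by ring
  · exact_mod_cast Nat.pow_le_pow_left (Nat.add_le_add_right hm 1) 2

end AlmostIntertwined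

/-! ### Zero entropy of index shifts -/

section Shift

variable {B I J : Type*} [CStarAlgebra B] [PartialOrder B] [StarOrderedRing B]
  [FiniteDimensional ℂ B] {Dj : J → Type*} [∀ j, CStarAlgebra (Dj j)]
  {ψj : ∀ j, CondExp B (Dj j)} {A : Type*} [CStarAlgebra A] {φ : CondExp B A}
  {emb : ∀ p : I × J, Dj p.2 →⋆ₐ[ℂ] A} {α : A ≃⋆ₐ[ℂ] A} {σ : I → I}
  {H : Type*} [NormedAddCommGroup H] [InnerProductSpace ℂ H] [CompleteSpace H]
  {π : A →⋆ₐ[ℂ] (H →L[ℂ] H)} {Ω : H}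

theorem iterate_emb (hα : ∀ p x, α (emb p x) = emb (σ p.1, p.2) x) (k : ℕ) (p : I × J)
    (x : Dj p.2) : (⇑α)^[k] (emb p x) = emb (σ^[k] p.1, p.2) x := by
  induction k with
  | zero => rfl
  | succ k ih => rw [Function.iterate_succ_apply', ih, hα, Function.iterate_succ_apply']

variable [DecidableEq (I × J)] (hA : IsReducedFreeProduct (fun p : I × J => ψj p.2) φ emb)
  (hα : ∀ p x, α (emb p x) = emb (σ p.1, p.2) x) (hαB : ∀ b, α (φ.incl b) = φ.incl b)
  (hΩ : ∀ a b, ⟪π a Ω, π b Ω⟫_ℂ = regularTrace B (φ.exp (star a * b)))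
  (hd : DenseRange fun a => π a Ω)
include hA hα hαB hΩ hd

/-- The iterates of a letter, for frames that contain the shifted index. -/
theorem almostIntertwined_letter (p : I × J) (x : Dj p.2) (k : ℕ) {S : Finset (I × J)}
    (hS : (σ^[k] p.1, p.2) ∈ S) :
    AlmostIntertwined (π.comp φ.incl) (fun p => (π.comp (emb p)).range)
      (firstProj (fun p : I × J => ψj p.2) φ emb π Ω) Ω S (5 * ‖(ψj p.2).centre x‖)
      (π ((⇑α)^[k] (emb p x))) := by
  have hP := freeCompression hA hΩ hd
  rw [iterate_emb hα, ← (ψj p.2).incl_add_centre x, map_add, map_add,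
    hA.emb_incl (σ^[k] p.1, p.2)]
  have h1 := AlmostIntertwined.letter hP hS
    (x := π (emb (σ^[k] p.1, p.2) ((ψj p.2).centre x))) ⟨_, rfl⟩ (by
      rw [compress_emb hA hΩ hd, (ψj p.2).exp_centre, map_zero, map_zero, zero_mul])
  have h2 := (AlmostIntertwined.incl (S := S) hP ((ψj p.2).exp x)).add h1
  rw [(ψj p.2).incl_add_centre x]
  refine h2.mono ?_
  rw [zero_add]
  gcongr
  exact (NonUnitalStarAlgHom.norm_apply_le π _).trans (NonUnitalStarAlgHom.norm_apply_le _ _)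

/-- Iterates only relabel the letters and do not increase norms, so one constant serves all `k`;
only the index set required in `S` moves. -/
theorem exists_almostIntertwined {a : A}
    (ha : a ∈ StarAlgebra.adjoin ℂ (Set.range φ.incl ∪ ⋃ p, Set.range (emb p))) :
    ∃ (F : Finset (I × J)) (c : ℝ), 0 ≤ c ∧ ∀ (k : ℕ) (S : Finset (I × J)),
      (∀ p ∈ F, (σ^[k] p.1, p.2) ∈ S) →
      AlmostIntertwined (π.comp φ.incl) (fun p => (π.comp (emb p)).range)
        (firstProj (fun p : I × J => ψj p.2) φ emb π Ω) Ω S c (π ((⇑α)^[k] a)) := by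
  have hP := freeCompression hA hΩ hd
  have hn : ∀ k a, ‖π ((⇑α)^[k] a)‖ ≤ ‖a‖ := fun k a => by
    refine (NonUnitalStarAlgHom.norm_apply_le π _).trans ?_
    induction k with
    | zero => rfl
    | succ k ih =>
      rw [Function.iterate_succ_apply']
      exact (NonUnitalStarAlgHom.norm_apply_le α _).trans ih
  have hw := mem_wordSpan_of_mem_starAdjoin hA.emb_incl ha
  clear ha
  induction hw using Submodule.span_induction with
  | mem w hw =>
    obtain ⟨l, b, -, rfl⟩ := hw
    induction l with
    | nil =>
      refine ⟨∅, 0, le_rfl, fun k S _ => ?_⟩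
      have e : (⇑α)^[k] (φ.incl b) = φ.incl b := Function.iterate_fixed (hαB b) k
      have := AlmostIntertwined.incl (S := S) hP b
      simp only [wordVal, List.map_nil, List.prod_nil, one_mul]
      exact (congrArg π e) ▸ this
    | cons q l ih =>
      obtain ⟨p, x⟩ := q
      obtain ⟨F, c, hc, h⟩ := ih
      refine ⟨insert p F, ‖emb p x‖ * c + 5 * ‖(ψj p.2).centre x‖ *
        ‖wordVal (fun i => (emb i).toAlgHom) φ.incl.toAlgHom l b‖, by positivity, fun k S hS => ?_⟩
      rw [wordVal_cons, iterate_map_mul, map_mul]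
      refine ((almostIntertwined_letter hA hα hαB hΩ hd p x k (hS p (by simp))).mul hP
        (by positivity) (h k S fun q hq => hS q (by simp [hq]))).mono ?_
      gcongr
      · exact hn k _
      · exact hn k _
  | zero =>
    refine ⟨∅, 0, le_rfl, fun k S _ => ?_⟩
    rw [iterate_map_zero, map_zero]
    exact .zero
  | add u v _ _ hu hv =>
    obtain ⟨F, c, hc, h⟩ := hu
    obtain ⟨F', c', hc', h'⟩ := hv
    refine ⟨F ∪ F', c + c', by positivity, fun k S hS => ?_⟩
    rw [iterate_map_add, map_add]
    exact (h k S fun q hq => hS q (by simp [hq])).add (h' k S fun q hq => hS q (by simp [hq]))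
  | smul t u _ hu =>
    obtain ⟨F, c, hc, h⟩ := hu
    refine ⟨F, ‖t‖ * c, by positivity, fun k S hS => ?_⟩
    have e : (⇑α)^[k] (t • u) = t • (⇑α)^[k] u :=
      (show Function.Commute α (t • ·) from fun x => map_smul α t x).iterate_left k u
    rw [e, map_smul]
    exact (h k S hS).smul t

theorem htRep_nonpos [PartialOrder A] [StarOrderedRing A] [∀ j, FiniteDimensional ℂ (Dj j)] :
    htRep π α ≤ 0 := by
  have hP := freeCompression hA hΩ hd
  refine iSup_le fun ω => iSup₂_le fun δ hδ => ?_
  have happ : ∀ a : A, ∃ a' ∈ StarAlgebra.adjoin ℂ (Set.range φ.incl ∪ ⋃ p, Set.range (emb p)),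
      ‖a - a'‖ ≤ δ / 4 := fun a => by
    have ha : a ∈ (StarAlgebra.adjoin ℂ
        (Set.range φ.incl ∪ ⋃ i, Set.range (emb i))).topologicalClosure := by
      rw [hA.generates]; trivial
    obtain ⟨a', h, h'⟩ := Metric.mem_closure_iff.mp ha (δ / 4) (by positivity)
    exact ⟨a', h, (dist_eq_norm a a' ▸ h').le⟩
  choose a' ha' hδ' using happ
  choose F c hc h using fun a => exists_almostIntertwined hA hα hαB hΩ hd (ha' a)
  set C := ∑ a ∈ ω, c a
  -- The constant `C` does not involve the number `n` of iterates, so neither does `N`; this makes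
  -- the exponent of the rank bound constant.
  obtain ⟨N, hN, hCN⟩ : ∃ N : ℕ, 1 ≤ N ∧ C * (1 / √N) ≤ δ / 4 := by
    have h1 : Filter.Tendsto (fun N : ℕ => C * (1 / √(N : ℝ))) Filter.atTop (nhds (C * 0)) := by
      refine Filter.Tendsto.const_mul _ ?_
      simp only [one_div]
      exact tendsto_inv_atTop_zero.comp (Real.tendsto_sqrt_atTop.comp tendsto_natCast_atTop_atTop)
    rw [mul_zero] at h1
    obtain ⟨N, hN⟩ := ((Filter.eventually_ge_atTop 1).and
      (h1.eventually_le_const (by positivity : 0 < δ / 4))).exists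
    exact ⟨N, hN⟩
  obtain ⟨m, r, hr⟩ := exists_trace_basis (B := B)
  set T := ω.biUnion F
  set g := ∑ p ∈ T, Module.finrank ℂ (Dj p.2)
  refine htGrowth_nonpos π α (c := ((N + 1) * (m * (g + 1) ^ (N + 1)) + 1) ^ 2)
    (d := (N + 1) * 2) (by positivity) fun n hn => ?_
  let f : ℕ × (I × J) → I × J := fun q => (σ^[q.1] q.2.1, q.2.2)
  let S := (Finset.range n ×ˢ T).image f
  obtain ⟨L, hG, hR⟩ := exists_letterFrame hΩ hA hd hr S
  have hG' : Fintype.card L.G ≤ n * g := hG.trans <| calc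
    _ ≤ ∑ q ∈ Finset.range n ×ˢ T, Module.finrank ℂ (Dj (f q).2) := by
      refine Finset.sum_image_le_of_nonneg (f := fun p : I × J => Module.finrank ℂ (Dj p.2)) ?_
      exact fun _ _ => Nat.zero_le _
    _ = n * g := by
      rw [Finset.sum_product]
      exact (Finset.sum_const g).trans (by simp)
  refine (rcp_le_of_letterFrame π hP L hN hδ hCN fun b hb => ?_).trans ?_
  · simp only [Set.mem_iUnion, Finset.mem_range, Set.mem_image] at hb
    obtain ⟨k, hk, a, ha, rfl⟩ := hb
    refine ⟨(⇑α)^[k] (a' a), ?_, (h a k S fun p hp => ?_).mono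
      (Finset.single_le_sum (fun a _ => hc a) ha)⟩
    · rw [← iterate_map_sub]
      refine le_trans ?_ (hδ' a)
      generalize a - a' a = x
      clear hk
      induction k with
      | zero => rfl
      | succ k ih =>
        rw [Function.iterate_succ_apply']
        exact (NonUnitalStarAlgHom.norm_apply_le α _).trans ih
    · exact Finset.mem_image.mpr ⟨(k, p), Finset.mem_product.mpr
        ⟨Finset.mem_range.mpr hk, Finset.mem_biUnion.mpr ⟨a, ha, hp⟩⟩, rfl⟩
  · rw [hR]
    norm_cast
    calc _ ≤ (((N + 1) * (m * (n * (g + 1)) ^ (N + 1)) + 1 * n ^ (N + 1))) ^ 2 := by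
          gcongr
          · nlinarith
          · rw [one_mul]; exact Nat.one_le_pow _ _ hn
      _ = _ := by
          rw [mul_pow n, pow_mul n]
          ring

end Shift

end

theorem corollary5
    {B : Type uB} [CStarAlgebra B] [PartialOrder B] [StarOrderedRing B] [FiniteDimensional ℂ B]
    {J : Type uJ} {Dj : J → Type uDj} [∀ j, CStarAlgebra (Dj j)]
    [∀ j, FiniteDimensional ℂ (Dj j)]
    (ψj : ∀ j, CondExp B (Dj j)) (hψj : ∀ j, (ψj j).FaithfulGNS)
    {D : Type uD} [CStarAlgebra D] (ψ : CondExp B D) (emb : ∀ j, Dj j →⋆ₐ[ℂ] D)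
    (hD : IsReducedFreeProduct ψj ψ emb) :
    HasZEFP.{uB, uA, uI, uD} ψ := by
  classical
  intro I A _ _ _ φ embI hA σ
  refine ⟨hA.exists_isFreePermutation σ, fun α hα => le_antisymm ?_ (ht_nonneg α)⟩
  -- For the upper bound one faithful representation suffices.
  refine iInf_le_of_le φ.traceFunctional.GNS <|
    iInf_le_of_le (inferInstance : NormedAddCommGroup φ.traceFunctional.GNS) <|
    iInf_le_of_le (inferInstance : InnerProductSpace ℂ φ.traceFunctional.GNS) <|
    iInf_le_of_le (inferInstance : CompleteSpace φ.traceFunctional.GNS) <|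
    iInf_le_of_le φ.traceFunctional.gnsStarAlgHom <|
    iInf_le_of_le (φ.gns_injective hA.faithful) ?_
  exact htRep_nonpos (hD.iterate hA) (σ := σ) (fun p x => hα.1 p.1 (emb p.2 x)) hα.2
    φ.inner_gns_vacuum φ.denseRange_gns_vacuum
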